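/- **Setting.** Let $P=\{1,\dots,\bar x\}\times\{1,\dots,\bar y\}$ be a grid, $P_O\subseteq P$ a set of obstacle cells, $P_F=P\setminus P_O$ the feasible cells, and $S\subseteq P_F$ a set of stations. There are $n$ robots; robot $i$ is assigned a station $\sigma_i\in S$. A cycle has $T\ge 1$ time steps. From a cell $(x,y)$ a robot can be at the next time step in any cell of $N(x,y)=\{(x',y')\in P_F: |x'-x|\le 1,\ |y'-y|\le 1\}$. The set of feasible trajectories of robot $i$ is $$\mathbf P_i=\{(p_i^0,\dots,p_i^T): p_i^0=p_i^T=\sigma_i,\ p_i^{t+1}\in N(p_i^t)\text{ for } 0\le t\le T-1\},\qquad \mathbf P=\mathbf P_1\times\cdots\times\mathbf P_n .$$ There are $k$ tasks; task $j$ consists of a required number of robots $c_j^*\in\mathbb N$, a location $l_j\in P_F$, times $t^a_j<t^d_j$ in $\{0,\dots,T\}$ and a value $v_j\ge 0$. For a trajectory profile $\mathbf p$, task $j$ belongs to the set $\tau^*(\mathbf p)$ of completed tasks if for some $t\in[t_j^a,t_j^d-1]$ at least $c_j^*$ robots $i$ satisfy $p_i^t=p_i^{t+1}=l_j$; $\tau^*(\mathbf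 p_{-i})$ is the set of tasks completed when robot $i$ is removed (it is not counted). The total completed value is $f(\mathbf p)=\sum_{j\in\tau^*(\mathbf p)}v_j$. **Game.** For each robot $i$ let the action set $A_i$ be a subset of $\mathbf P_i$ of minimum cardinality among those subsets for which (1) every $\mathbf p_i\in A_i$ has $p_i^t=p_i^{t+1}$ for some $t\in\{0,\dots,T-1\}$, and (2) for every $\mathbf q_i\in\mathbf P_i\setminus A_i$ there is $\mathbf p_i\in A_i$ such that $p_i^t=p_i^{t+1}=q_i^t$ for all $t$ with $q_i^t=q_i^{t+1}$. Let $A=A_1\times\cdots\times A_n$. The utility of robot $i$ is $U_i(\mathbf p)=\sum_{j\in\tau^*(\mathbf p)\setminus\tau^*(\mathbf p_{-i})}v_j$ for $\mathbf p\in A$. **Learning.** All robots follow payoff-based log-linear learning with parameters $\epsilon\in(0,1)$ and $m>0$ over the cycles $t=0,1,2,\dots$: the initial $\mathbf p(0)\in A$ is arbitrary and $x_i(0)=0$ for all $i$. Given the history up to cycle $t$, the robots update independently of each other. If $x_i(t)=0$, then with probability $\epsilon^m$ the action $\mathbf p_i(t+1)$ is drawn uniformly from $A_i$ and $x_i(t+1)=1$,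 and with probability $1-\epsilon^m$, $\mathbf p_i(t+1)=\mathbf p_i(t)$ and $x_i(t+1)=0$. If $x_i(t)=1$, then $x_i(t+1)=0$ and $\mathbf p_i(t+1)$ equals $\mathbf p_i(t-1)$ with probability $\alpha$ and $\mathbf p_i(t)$ with probability $1-\alpha$, where $\alpha=\epsilon^{-U_i(\mathbf p(t-1))}/\bigl(\epsilon^{-U_i(\mathbf p(t-1))}+\epsilon^{-U_i(\mathbf p(t))}\bigr)$. **Theorem.** The maximum of $f$ over $\mathbf P$ exists, and there is $m_0>0$ (depending only on the problem data and the action sets) such that for every $m\ge m_0$ the following holds. For every $\epsilon\in(0,1)$ the limit $$F(\epsilon)=\lim_{t^*\to\infty}\frac1{t^*+1}\sum_{t=0}^{t^*}f(\mathbf p(t))$$ exists almost surely and is a constant which does not depend on the initial profile, and $$\lim_{\epsilon\to0^+}F(\epsilon)=\max_{\mathbf q\in\mathbf P}f(\mathbf q).$$ -/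

import Mathlib

open Filter Topology MeasureTheory

/-! ### The environment, the tasks and the distributed task execution (DTE) problem -/

/-- The cells of a planar grid, as pairs of integer coordinates. -/
abbrev Cell : Type := ℤ × ℤ

/-- A grid `{1, …, width} × {1, …, height}` in which some cells are obstacles. -/
structure GridEnv where
  width : ℕ
  height : ℕ
  obstacles : Finset Cell
  obstacles_subset :
    obstacles ⊆ Finset.Icc (1 : ℤ) (width : ℤ) ×ˢ Finset.Icc (1 : ℤ) (height : ℤ)

namespace GridEnv

/-- All cells of the grid. -/
noncomputable def cells (E : GridEnv) : Finset Cell :=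
  Finset.Icc (1 : ℤ) (E.width : ℤ) ×ˢ Finset.Icc (1 : ℤ) (E.height : ℤ)

/-- The feasible (obstacle-free) cells. -/
noncomputable def free (E : GridEnv) : Finset Cell := E.cells \ E.obstacles

/-- The feasible cells that can be occupied one time step after being at `c`
(`c` itself included when it is feasible). -/
def nbhd (E : GridEnv) (c : Cell) : Set Cell :=
  {c' | c' ∈ E.free ∧ |c'.1 - c.1| ≤ 1 ∧ |c'.2 - c.2| ≤ 1}

end GridEnv

/-- A trajectory over one cycle of `T` time steps: the positions at the times `0, …, T`. -/
abbrev Trajectory (T : ℕ) : Type := Fin (T + 1) → Cell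

/-- A task: at least `required` robots have to stay together at `loc` for one time step
inside the time window `[arrival, departure]`. Completing it is worth `value`. -/
structure CoopTask (E : GridEnv) (T : ℕ) where
  required : ℕ
  loc : Cell
  loc_free : loc ∈ E.free
  arrival : ℕ
  departure : ℕ
  arrival_lt : arrival < departure
  departure_le : departure ≤ T
  value : ℝ
  value_nonneg : 0 ≤ value

/-- A DTE problem with `n` robots, `k` tasks and cycles of `T` time steps. -/
structure DTEProblem (n k T : ℕ) where
  env : GridEnv
  stations : Finset Cell
  stations_free : stations ⊆ env.free
  station : Fin n → Cell
  station_mem : ∀ i, station i ∈ stations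
  task : Fin k → CoopTask env T

namespace DTEProblem

variable {n k T : ℕ} (D : DTEProblem n k T)

/-- The feasible trajectories of robot `i`: they start and end at its station, and each step goes
to a neighbouring feasible cell or stays. -/
def feasible (i : Fin n) : Set (Trajectory T) :=
  {p | p 0 = D.station i ∧ p (Fin.last T) = D.station i ∧
    ∀ t : Fin T, p t.succ ∈ D.env.nbhd (p t.castSucc)}

/-- The feasible trajectory profiles. -/
def feasibleProfiles : Set (Fin n → Trajectory T) := {p | ∀ i, p i ∈ D.feasible i}

/-- The number of robots of `team` that stay at the location of task `j` from time `t`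
to time `t + 1`. -/
def counter (team : Finset (Fin n)) (p : Fin n → Trajectory T) (j : Fin k) (t : Fin T) : ℕ :=
  (team.filter fun i =>
    p i t.castSucc = (D.task j).loc ∧ p i t.succ = (D.task j).loc).card

/-- The tasks completed when only the robots of `team` are present. -/
def completed (team : Finset (Fin n)) (p : Fin n → Trajectory T) : Finset (Fin k) :=
  Finset.univ.filter fun j =>
    ∃ t : Fin T, (D.task j).arrival ≤ (t : ℕ) ∧ (t : ℕ) < (D.task j).departure ∧
      (D.task j).required ≤ D.counter team p j t

/-- The total value of the tasks completed by all robots. -/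
noncomputable def totalValue (p : Fin n → Trajectory T) : ℝ :=
  ∑ j ∈ D.completed Finset.univ p, (D.task j).value

/-- The wonderful-life utility of robot `i`: the total value of the completed tasks that would not
be completed if robot `i` were removed from the system. -/
noncomputable def wonderfulLife (i : Fin n) (p : Fin n → Trajectory T) : ℝ :=
  ∑ j ∈ D.completed Finset.univ p \ D.completed (Finset.univ.erase i) p, (D.task j).value

/-- The constraints on a candidate action set `A` of robot `i`: it consists of feasible
trajectories, each of them has a stay, and each excluded feasible trajectory `q` has all its
stays included in some member of `A`. -/
def IsAdmissibleActionSet (i : Fin n) (A : Finset (Trajectory T)) : Prop :=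
  (∀ p ∈ A, p ∈ D.feasible i) ∧
  (∀ p ∈ A, ∃ t : Fin T, p t.castSucc = p t.succ) ∧
  (∀ q ∈ D.feasible i, q ∉ A → ∃ p ∈ A, ∀ t : Fin T, q t.castSucc = q t.succ →
    p t.castSucc = q t.castSucc ∧ p t.succ = q t.castSucc)

/-- `A` is an admissible action set of robot `i` of minimum cardinality. -/
def IsActionSet (i : Fin n) (A : Finset (Trajectory T)) : Prop :=
  D.IsAdmissibleActionSet i A ∧
    ∀ B : Finset (Trajectory T), D.IsAdmissibleActionSet i B → A.card ≤ B.card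

/-- The utilities of the game with action sets `A i`, in which the robots play trajectories
and receive their wonderful-life utilities. -/
noncomputable def gameUtility (A : Fin n → Finset (Trajectory T)) (i : Fin n)
    (a : (j : Fin n) → A j) : ℝ :=
  D.wonderfulLife i fun j => (a j : Trajectory T)

end DTEProblem

/-! ### Payoff-based log-linear learning in a finite game -/

section PBLLL

variable {I : Type*} {Act : I → Type*}

/-- The probability with which an experimenting player `i` returns to its previous action, when
the previous action profile was `prev` and the current one is `cur`. -/
noncomputable def revertProb (U : I → ((i : I) → Act i) → ℝ) (ε : ℝ)
    (prev cur : (i : I) → Act i) (i : I) : ℝ :=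
  ε ^ (-U i prev) / (ε ^ (-U i prev) + ε ^ (-U i cur))

/-- The probability that player `i` has action `a'` and experimentation flag `x'` at the next step,
when the previous and current action profiles are `prev` and `cur` and its current flag is `xi`.
A player that is not experimenting starts, with probability `ε ^ m`, to experiment with an action
drawn uniformly, and otherwise repeats its action; an experimenting player settles at its previous
or at its current action. -/
noncomputable def playerUpdate [∀ i, Fintype (Act i)] [∀ i, DecidableEq (Act i)]
    (U : I → ((i : I) → Act i) → ℝ) (ε m : ℝ) (prev cur : (i : I) → Act i) (i : I) :
    (xi : Bool) → (a' : Act i) → (x' : Bool) → ℝ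
  | false, _, true => ε ^ m * (1 / (Fintype.card (Act i) : ℝ))
  | false, a', false => (1 - ε ^ m) * (if a' = cur i then 1 else 0)
  | true, _, true => 0
  | true, a', false =>
      revertProb U ε prev cur i * (if a' = prev i then 1 else 0) +
        (1 - revertProb U ε prev cur i) * (if a' = cur i then 1 else 0)

/-- The random sequences `p t` (action profiles) and `x t` (experimentation flags) are generated by
payoff-based log-linear learning with parameters `ε` and `m`: no player experiments at time `0`,
the initial action profile is arbitrary, and, given the history up to time `t`, the players update
independently of each other with the probabilities `playerUpdate`. (At `t = 0` the profile at
`t - 1` is irrelevant, since no player experiments then.) -/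
structure IsPBLLL [Fintype I] [∀ i, Fintype (Act i)] [∀ i, DecidableEq (Act i)]
    (U : I → ((i : I) → Act i) → ℝ) (ε m : ℝ)
    {Ω : Type*} [MeasurableSpace Ω] (μ : Measure Ω)
    (p : ℕ → Ω → (i : I) → Act i) (x : ℕ → Ω → I → Bool) : Prop where
  measurableSet_state : ∀ (t : ℕ) (a : (i : I) → Act i) (b : I → Bool),
    MeasurableSet {ω | p t ω = a ∧ x t ω = b}
  init : ∀ᵐ ω ∂μ, ∀ i, x 0 ω i = false
  transition : ∀ (t : ℕ) (a : ℕ → (i : I) → Act i) (b : ℕ → I → Bool),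
    μ.real {ω | ∀ s ≤ t + 1, p s ω = a s ∧ x s ω = b s} =
      μ.real {ω | ∀ s ≤ t, p s ω = a s ∧ x s ω = b s} *
        ∏ i, playerUpdate U ε m (a (t - 1)) (a t) i (b t i) (a (t + 1) i) (b (t + 1) i)

end PBLLL

/-!
The wonderful-life utilities are marginal contributions to the total value `f`, so `f` is an exact
potential of the game. An action set contains, for every feasible trajectory, an action with at
least the same stays; hence the maximum `M` of `f` over the action profiles is also its maximum over
all feasible profiles, and it remains to study payoff-based log-linear learning in a finite game
with an exact potential `φ` such that `0 ≤ φ ≤ M`.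

The triple (previous profile, current profile, experimentation flags) is a finite Markov chain in
which one state is reachable from all states. Such a chain has a stationary distribution `π`, and
every observable `g` satisfies a Poisson equation `g - π g = h - P h`. The centred partial sums of
`g` are therefore a martingale with bounded increments, up to a bounded error. Their second moments
grow linearly, and Chebyshev's inequality along the squares gives almost sure convergence of the
averages to `π g` (`IsMarkovChain.ae_tendsto_average`).

It remains to show that `π φ → M` as `ε → 0`, and this is done without a spectral gap or resistance
trees. Let `δ = ε ^ m` be the experimentation rate and let `ν a` be the stationary probability of
being at `a` without experiments. Testing stationarity against the expectation of a function `G`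
after all current experiments are settled shows that `∑ a, ν a * (L G) a = O(δ ‖G‖)`, uniformly in
`ε`, where `L` is the generator of log-linear learning with uniform proposals
(`abs_sum_settledMass_mul_generator_le`). Since `φ` is a potential, `L` is reversible with respect
to the Gibbs weights `w a = ε ^ (-φ a) ≥ 1`. For `G = ν / w`, which has values in `[0, 1]`, the left
side is minus the Dirichlet form of `G`; since the conductances are bounded below, `ν / w` is
constant up to `O(√δ)` (`IsExactPotential.exists_density_bound`). Comparison with a maximizer of `φ`
gives `ν a ≤ ε ^ (M - φ a) + O(ε ^ (m / 2 - M))`, which tends to zero if `φ a < M` and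
`m > 2 M`, while experiments have probability `O(δ)`.
-/

/-! ### Finite stochastic matrices: stationary distributions and the Poisson equation -/

section FiniteChain

open Matrix

variable {Z : Type*} [Fintype Z] [DecidableEq Z] {P : Matrix Z Z ℝ}

/-- The absolute value of a left fixed vector of a stochastic matrix is again a left fixed vector,
since it is dominated by its image, which has the same total mass. -/
theorem exists_stationary_distribution [Nonempty Z] (hP : P ∈ rowStochastic ℝ Z) :
    ∃ π : Z → ℝ, (∀ z, 0 ≤ π z) ∧ ∑ z, π z = 1 ∧ π ᵥ* P = π := by
  have h0 : ∀ i j, 0 ≤ P i j := fun i j => nonneg_of_mem_rowStochastic hP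
  have h1 := sum_row_of_mem_rowStochastic hP
  have hdet : (P - 1).det = 0 := by
    rw [← exists_mulVec_eq_zero_iff]
    refine ⟨1, one_ne_zero, ?_⟩
    rw [sub_mulVec, one_vecMul_of_mem_rowStochastic hP, one_mulVec, sub_self]
  obtain ⟨v, hv, hvP⟩ := exists_vecMul_eq_zero_iff.2 hdet
  rw [vecMul_sub, vecMul_one, sub_eq_zero] at hvP
  have hle : ∀ z, |v z| ≤ ((fun y => |v y|) ᵥ* P) z := by
    intro z
    calc |v z| = |∑ y, v y * P y z| := by
          conv_lhs => rw [← hvP]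
          rfl
      _ ≤ ∑ y, |v y * P y z| := Finset.abs_sum_le_sum_abs _ _
      _ = ∑ y, |v y| * P y z :=
          Finset.sum_congr rfl fun y _ => by rw [abs_mul, abs_of_nonneg (h0 y z)]
  have hmass : ∑ z, |v z| = ∑ z, ((fun y => |v y|) ᵥ* P) z := by
    simp only [vecMul, dotProduct]
    rw [Finset.sum_comm]
    simp only [← Finset.mul_sum, h1, mul_one]
  have heq := (Finset.sum_eq_sum_iff_of_le fun z _ => hle z).1 hmass
  have hpos : 0 < ∑ z, |v z| := by
    obtain ⟨z, hz⟩ := Function.ne_iff.1 hv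
    exact Finset.sum_pos' (fun _ _ => abs_nonneg _) ⟨z, Finset.mem_univ _, abs_pos.2 hz⟩
  refine ⟨(∑ z, |v z|)⁻¹ • fun y => |v y|, fun z => ?_, ?_, ?_⟩
  · exact mul_nonneg (inv_nonneg.2 hpos.le) (abs_nonneg _)
  · simp only [Pi.smul_apply, smul_eq_mul, ← Finset.mul_sum]
    exact inv_mul_cancel₀ hpos.ne'
  · rw [smul_vecMul]
    congr 1
    funext z
    exact (heq z (Finset.mem_univ _)).symm

/-- Maximum principle: a harmonic function takes the value of its maximum at every state which is
reachable from a maximizer. -/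
theorem harmonic_le_of_reachable (hP : P ∈ rowStochastic ℝ Z) {h : Z → ℝ} (hh : P *ᵥ h = h) {z₀ : Z}
    (hreach : ∀ z, Relation.ReflTransGen (fun a b => 0 < P a b) z z₀) (z : Z) : h z ≤ h z₀ := by
  obtain ⟨y, -, hy⟩ := Finset.exists_max_image Finset.univ h ⟨z, Finset.mem_univ z⟩
  have hclosed : ∀ z', Relation.ReflTransGen (fun a b => 0 < P a b) y z' → h z' = h y := by
    intro z' hz'
    induction hz' with
    | refl => rfl
    | @tail b c _ hbc ih =>
      have hz : ∑ x, P b x * (h y - h x) = 0 := by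
        have := congrFun hh b
        simp only [mulVec, dotProduct] at this
        simp only [mul_sub, Finset.sum_sub_distrib, ← Finset.sum_mul,
          sum_row_of_mem_rowStochastic hP, this, ih, one_mul, sub_self]
      have := (Finset.sum_eq_zero_iff_of_nonneg fun x _ =>
        mul_nonneg (nonneg_of_mem_rowStochastic hP) (sub_nonneg.2 (hy x (Finset.mem_univ _)))).1
        hz c (Finset.mem_univ _)
      rcases mul_eq_zero.1 this with h' | h'
      · exact absurd h' hbc.ne'
      · linarith
  rw [hclosed z₀ (hreach y)]
  exact hy z (Finset.mem_univ _)

/-- If one state is reachable from all states, every observable differs from its stationary mean by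
some `h - P h`. The map `h ↦ h - P h + π h` is injective, because harmonic functions are constant,
hence surjective. -/
theorem exists_poisson_solution (hP : P ∈ rowStochastic ℝ Z) {π : Z → ℝ} (hπ1 : ∑ z, π z = 1)
    (hπP : π ᵥ* P = π) {z₀ : Z}
    (hreach : ∀ z, Relation.ReflTransGen (fun a b => 0 < P a b) z z₀) (f : Z → ℝ) :
    ∃ h : Z → ℝ, ∀ z, f z - π ⬝ᵥ f = h z - (P *ᵥ h) z := by
  have hconst : ∀ c : ℝ, π ⬝ᵥ (fun _ => c) = c := fun c => by
    simp only [dotProduct, ← Finset.sum_mul, hπ1, one_mul]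
  have hinv : ∀ h : Z → ℝ, π ⬝ᵥ (P *ᵥ h) = π ⬝ᵥ h := fun h => by
    rw [dotProduct_mulVec, hπP]
  let Φ : (Z → ℝ) →ₗ[ℝ] (Z → ℝ) :=
    { toFun := fun h => h - P *ᵥ h + fun _ => π ⬝ᵥ h
      map_add' := fun g h => by
        funext z
        simp only [mulVec_add, dotProduct_add, Pi.add_apply, Pi.sub_apply]
        ring
      map_smul' := fun c h => by
        funext z
        simp only [mulVec_smul, dotProduct_smul, Pi.add_apply, Pi.sub_apply, Pi.smul_apply,
          smul_eq_mul, RingHom.id_apply]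
        ring }
  have hΦ : ∀ h, Φ h = h - P *ᵥ h + fun _ => π ⬝ᵥ h := fun _ => rfl
  have hmean : ∀ h, π ⬝ᵥ Φ h = π ⬝ᵥ h := fun h => by
    rw [hΦ, dotProduct_add, dotProduct_sub, hinv, hconst, sub_self, zero_add]
  have hinj : Function.Injective Φ := by
    rw [← LinearMap.ker_eq_bot, LinearMap.ker_eq_bot']
    intro h hh
    have hm : π ⬝ᵥ h = 0 := by rw [← hmean, hh, dotProduct_zero]
    have hharm : P *ᵥ h = h := by
      funext z
      have := congrFun hh z
      simp only [hΦ, hm, Pi.add_apply, Pi.sub_apply, Pi.zero_apply] at this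
      linarith
    have hneg : P *ᵥ (-h) = -h := by rw [mulVec_neg, hharm]
    have hc : h = fun _ => h z₀ := by
      funext z
      refine le_antisymm (harmonic_le_of_reachable hP hharm hreach z) ?_
      have := harmonic_le_of_reachable hP hneg hreach z
      simpa using this
    have : h z₀ = 0 := by rw [← hconst (h z₀), ← hc, hm]
    rw [hc, this]
    rfl
  obtain ⟨h, hh⟩ := LinearMap.injective_iff_surjective.1 hinj f
  refine ⟨h, fun z => ?_⟩
  rw [← hh, hmean, hΦ]
  simp only [Pi.add_apply, Pi.sub_apply]
  ring

end FiniteChain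

/-! ### The ergodic theorem for finite Markov chains -/

section ErgodicTheorem

open Matrix

/-- Nonnegative random variables whose expectations are summable tend to zero almost surely. -/
theorem ae_tendsto_zero_of_summable_integral {Ω : Type*} [MeasurableSpace Ω] {μ : Measure Ω}
    {f : ℕ → Ω → ℝ} (hf0 : ∀ k ω, 0 ≤ f k ω) (hm : ∀ k, Measurable (f k))
    (hint : ∀ k, Integrable (f k) μ) (hsum : Summable fun k => ∫ ω, f k ω ∂μ) :
    ∀ᵐ ω ∂μ, Tendsto (fun k => f k ω) atTop (𝓝 0) := by
  have hm' : ∀ k, Measurable fun ω => ENNReal.ofReal (f k ω) := fun k => (hm k).ennreal_ofReal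
  have hfin : ∫⁻ ω, ∑' k, ENNReal.ofReal (f k ω) ∂μ ≠ ⊤ := by
    rw [lintegral_tsum fun k => (hm' k).aemeasurable]
    have : ∀ k, ∫⁻ ω, ENNReal.ofReal (f k ω) ∂μ = ENNReal.ofReal (∫ ω, f k ω ∂μ) := fun k =>
      (ofReal_integral_eq_lintegral_ofReal (hint k) (ae_of_all _ (hf0 k))).symm
    simp only [this]
    exact hsum.tsum_ofReal_ne_top
  filter_upwards [ae_lt_top (Measurable.tsum hm') hfin] with ω hω
  have h := ENNReal.tendsto_atTop_zero_of_tsum_ne_top hω.ne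
  have h2 := (ENNReal.tendsto_toReal ENNReal.zero_ne_top).comp h
  simpa [Function.comp_def, ENNReal.toReal_ofReal (hf0 _ ω)] using h2

/-- If the increments of `S` are bounded, then `S N / N → 0` follows from convergence along the
squares. -/
theorem tendsto_div_of_tendsto_div_sq {S : ℕ → ℝ} {K : ℝ} (hK : ∀ N, |S (N + 1) - S N| ≤ K)
    (hS : Tendsto (fun k : ℕ => S ((k + 1) ^ 2) / ((k + 1 : ℕ) : ℝ) ^ 2) atTop (𝓝 0)) :
    Tendsto (fun N : ℕ => S (N + 1) / ((N : ℝ) + 1)) atTop (𝓝 0) := by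
  have hK0 : 0 ≤ K := (abs_nonneg _).trans (hK 0)
  have hgap : ∀ a b : ℕ, |S (a + b) - S a| ≤ K * b := by
    intro a b
    induction b with
    | zero => simp
    | succ b ih =>
      calc |S (a + (b + 1)) - S a| = |(S (a + b + 1) - S (a + b)) + (S (a + b) - S a)| := by
            rw [← add_assoc]; congr 1; ring
        _ ≤ K + K * b := (abs_add_le _ _).trans (add_le_add (hK _) ih)
        _ = K * ((b + 1 : ℕ) : ℝ) := by push_cast; ring
  -- `r N ^ 2` is the largest square below `N + 1`, with `r N ≥ 1`
  set r : ℕ → ℕ := fun N => Nat.sqrt (N + 1) - 1 with hr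
  have hr1 : ∀ N, r N + 1 = Nat.sqrt (N + 1) := fun N => by
    have : 0 < Nat.sqrt (N + 1) := Nat.sqrt_pos.2 (Nat.succ_pos N)
    simp only [hr]; omega
  have hlow : ∀ N, (r N + 1) ^ 2 ≤ N + 1 := fun N => by rw [hr1]; exact Nat.sqrt_le' _
  have hupp : ∀ N, N + 1 ≤ (r N + 1) ^ 2 + 2 * (r N + 1) := fun N => by
    rw [hr1]
    have := Nat.lt_succ_sqrt' (N + 1)
    simp only [Nat.succ_eq_add_one] at this
    nlinarith
  have hrtop : Tendsto r atTop atTop := by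
    refine tendsto_atTop.2 fun b => eventually_atTop.2 ⟨(b + 1) ^ 2, fun N hN => ?_⟩
    have : b + 1 ≤ Nat.sqrt (N + 1) := Nat.le_sqrt'.2 (by omega)
    simp only [hr]; omega
  have hbound : ∀ N : ℕ, |S (N + 1) / ((N : ℝ) + 1)| ≤
      |S ((r N + 1) ^ 2) / ((r N + 1 : ℕ) : ℝ) ^ 2| + 2 * K * (1 / ((r N : ℝ) + 1)) := by
    intro N
    obtain ⟨d, hd⟩ := Nat.exists_eq_add_of_le (hlow N)
    have hd2 : d ≤ 2 * (r N + 1) := by have := hupp N; omega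
    have hq : (0 : ℝ) < (r N : ℝ) + 1 := by positivity
    have hlowR : ((r N : ℝ) + 1) ^ 2 ≤ (N : ℝ) + 1 := by exact_mod_cast hlow N
    have hS1 : |S (N + 1)| ≤ |S ((r N + 1) ^ 2)| + 2 * K * ((r N : ℝ) + 1) := by
      have h1 := hgap ((r N + 1) ^ 2) d
      rw [← hd] at h1
      have h2 : K * (d : ℝ) ≤ K * (2 * ((r N : ℝ) + 1)) :=
        mul_le_mul_of_nonneg_left (by exact_mod_cast hd2) hK0
      have h3 := abs_sub_abs_le_abs_sub (S (N + 1)) (S ((r N + 1) ^ 2))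
      linarith
    rw [abs_div, abs_of_pos (by positivity : (0 : ℝ) < (N : ℝ) + 1), abs_div,
      abs_of_nonneg (sq_nonneg (((r N + 1 : ℕ) : ℝ)))]
    calc |S (N + 1)| / ((N : ℝ) + 1) ≤ |S (N + 1)| / ((r N : ℝ) + 1) ^ 2 := by gcongr
      _ ≤ (|S ((r N + 1) ^ 2)| + 2 * K * ((r N : ℝ) + 1)) / ((r N : ℝ) + 1) ^ 2 := by gcongr
      _ = _ := by push_cast; field_simp
  refine squeeze_zero_norm hbound ?_
  have h1 := (hS.comp hrtop).abs
  have h2 := ((tendsto_one_div_add_atTop_nhds_zero_nat (𝕜 := ℝ)).comp hrtop).const_mul (2 * K)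
  simpa [Function.comp_def] using h1.add h2

variable {Z : Type*} [Fintype Z] {Ω : Type*} [MeasurableSpace Ω]

/-- The random sequence `z` is a Markov chain with transition matrix `P` and an arbitrary initial
distribution; the Markov property is expressed by the probabilities of finite paths. -/
structure IsMarkovChain (P : Matrix Z Z ℝ) (μ : Measure Ω) (z : ℕ → Ω → Z) : Prop where
  measurableSet_state : ∀ (t : ℕ) (a : Z), MeasurableSet {ω | z t ω = a}
  transition : ∀ (t : ℕ) (a : ℕ → Z), μ.real {ω | ∀ s ≤ t + 1, z s ω = a s} =
    μ.real {ω | ∀ s ≤ t, z s ω = a s} * P (a t) (a (t + 1))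

namespace IsMarkovChain

variable {P : Matrix Z Z ℝ} {μ : Measure Ω} {z : ℕ → Ω → Z}

theorem measurable_comp (hz : IsMarkovChain P μ z) (t : ℕ) (g : Z → ℝ) :
    Measurable fun ω => g (z t ω) := by
  let _ : MeasurableSpace Z := ⊤
  have : Measurable (z t) := measurable_to_countable' fun a => hz.measurableSet_state t a
  exact measurable_from_top.comp this

/-- The increments `g (z (t + 1)) - (P g) (z t)` are orthogonal to every function of the past. -/
theorem integral_past_mul_increment [DecidableEq Z] [IsFiniteMeasure μ]
    (hP : P ∈ rowStochastic ℝ Z) (hz : IsMarkovChain P μ z) (t : ℕ)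
    (H : (Fin (t + 1) → Z) → ℝ) (g : Z → ℝ) :
    ∫ ω, H (fun s => z s ω) * (g (z (t + 1) ω) - (P *ᵥ g) (z t ω)) ∂μ = 0 := by
  let _ : MeasurableSpace Z := ⊤
  have hmeas : ∀ s, Measurable (z s) := fun s =>
    measurable_to_countable' fun a => hz.measurableSet_state s a
  let X : Ω → (Fin (t + 1) → Z) × Z := fun ω => (fun s => z s ω, z (t + 1) ω)
  have hX : Measurable X := 
    (measurable_pi_lambda (fun ω (s : Fin (t + 1)) => z s ω) fun s => hmeas s).prodMk (hmeas _)
  let G : (Fin (t + 1) → Z) × Z → ℝ := fun q => H q.1 * (g q.2 - (P *ᵥ g) (q.1 (Fin.last t)))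
  have hG : Measurable G := measurable_of_countable G
  have hlaw : ∀ b y, (μ.map X).real {(b, y)} =
      μ.real {ω | ∀ s : Fin (t + 1), z s ω = b s} * P (b (Fin.last t)) y := by
    intro b y
    let a : ℕ → Z := fun s => if hs : s < t + 1 then b ⟨s, hs⟩ else y
    have ha : ∀ s : Fin (t + 1), a s = b s := fun s => dif_pos s.2
    have hay : a (t + 1) = y := by simp [a]
    have hat : a t = b (Fin.last t) := ha (Fin.last t)
    have hpast : {ω | ∀ s ≤ t, z s ω = a s} = {ω | ∀ s : Fin (t + 1), z s ω = b s} := by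
      ext ω
      refine ⟨fun h s => (h s (Nat.lt_succ_iff.1 s.2)).trans (ha s), fun h s hs => ?_⟩
      exact (h ⟨s, Nat.lt_succ_of_le hs⟩).trans (ha ⟨s, Nat.lt_succ_of_le hs⟩).symm
    have hfull : X ⁻¹' {(b, y)} = {ω | ∀ s ≤ t + 1, z s ω = a s} := by
      ext ω
      simp only [X, Set.mem_preimage, Set.mem_singleton_iff, Prod.mk.injEq, Set.mem_ofPred_eq]
      constructor
      · rintro ⟨h1, h2⟩ s hs
        rcases Nat.lt_or_ge s (t + 1) with hs' | hs'
        · exact (congrFun h1 ⟨s, hs'⟩).trans (ha ⟨s, hs'⟩).symm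
        · obtain rfl : s = t + 1 := le_antisymm hs hs'
          rw [h2, hay]
      · intro h
        exact ⟨funext fun s => (h s s.2.le).trans (ha s), (h (t + 1) le_rfl).trans hay⟩
    rw [map_measureReal_apply hX (measurableSet_singleton _), hfull, hz.transition, hat, hay, hpast]
  have hint : ∫ ω, G (X ω) ∂μ = ∫ q, G q ∂(μ.map X) :=
    (integral_map hX.aemeasurable hG.aestronglyMeasurable).symm
  change ∫ ω, G (X ω) ∂μ = 0
  rw [hint, integral_fintype (Integrable.of_finite), Fintype.sum_prod_type]
  refine Finset.sum_eq_zero fun b _ => ?_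
  simp only [hlaw, G, smul_eq_mul]
  have hzero : ∑ y, P (b (Fin.last t)) y * (g y - (P *ᵥ g) (b (Fin.last t))) = 0 := by
    simp only [mul_sub, Finset.sum_sub_distrib, ← Finset.sum_mul, sum_row_of_mem_rowStochastic hP]
    simp [mulVec, dotProduct]
  calc _ = μ.real {ω | ∀ s : Fin (t + 1), z s ω = b s} * H b *
        ∑ y, P (b (Fin.last t)) y * (g y - (P *ᵥ g) (b (Fin.last t))) := by
        rw [Finset.mul_sum]
        exact Finset.sum_congr rfl fun y _ => by ring
    _ = 0 := by rw [hzero, mul_zero]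

/-- The martingale `∑ t < N, (h (z (t + 1)) - (P h) (z t))` has second moment `O(N)`, hence is
almost surely `o(N)`. -/
theorem ae_tendsto_martingale_div [DecidableEq Z] [IsProbabilityMeasure μ]
    (hP : P ∈ rowStochastic ℝ Z) (hz : IsMarkovChain P μ z) (h : Z → ℝ) :
    ∀ᵐ ω ∂μ, Tendsto (fun N : ℕ => (∑ t ∈ Finset.range (N + 1),
      (h (z (t + 1) ω) - (P *ᵥ h) (z t ω))) / ((N : ℝ) + 1)) atTop (𝓝 0) := by
  let D : ℕ → Ω → ℝ := fun t ω => h (z (t + 1) ω) - (P *ᵥ h) (z t ω)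
  let S : ℕ → Ω → ℝ := fun N ω => ∑ t ∈ Finset.range N, D t ω
  obtain ⟨K, hK⟩ : ∃ K : ℝ, ∀ t ω, |D t ω| ≤ K := by
    refine ⟨∑ a, ∑ b, |h b - (P *ᵥ h) a|, fun t ω => ?_⟩
    refine le_trans ?_ (Finset.single_le_sum (f := fun a => ∑ b, |h b - (P *ᵥ h) a|)
      (fun a _ => Finset.sum_nonneg fun b _ => abs_nonneg _) (Finset.mem_univ (z t ω)))
    exact Finset.single_le_sum (f := fun b => |h b - (P *ᵥ h) (z t ω)|)
      (fun b _ => abs_nonneg _) (Finset.mem_univ (z (t + 1) ω))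
  have hDm : ∀ t, Measurable (D t) := fun t =>
    (hz.measurable_comp (t + 1) h).sub (hz.measurable_comp t (P *ᵥ h))
  have hSm : ∀ N, Measurable (S N) := fun N => Finset.measurable_fun_sum _ fun t _ => hDm t
  have hSb : ∀ N ω, |S N ω| ≤ N * K := fun N ω => by
    refine (Finset.abs_sum_le_sum_abs _ _).trans ?_
    refine (Finset.sum_le_sum fun t _ => hK t ω).trans ?_
    simp
  have hbdd : ∀ {X : Ω → ℝ} (C : ℝ), Measurable X → (∀ ω, |X ω| ≤ C) → Integrable X μ :=
    fun C hm hb => Integrable.of_bound hm.aestronglyMeasurable C (ae_of_all _ hb)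
  have hSSint : ∀ N, Integrable (fun ω => S N ω ^ 2) μ := fun N =>
    hbdd ((N * K) ^ 2) ((hSm N).pow_const 2) fun ω => by
      rw [abs_pow]; exact pow_le_pow_left₀ (abs_nonneg _) (hSb N ω) 2
  have hDDint : ∀ N, Integrable (fun ω => D N ω ^ 2) μ := fun N =>
    hbdd (K ^ 2) ((hDm N).pow_const 2) fun ω => by
      rw [abs_pow]; exact pow_le_pow_left₀ (abs_nonneg _) (hK N ω) 2
  have hSDint : ∀ N, Integrable (fun ω => S N ω * D N ω) μ := fun N =>
    hbdd (N * K * K) ((hSm N).mul (hDm N)) fun ω => by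
      rw [abs_mul]
      exact mul_le_mul (hSb N ω) (hK N ω) (abs_nonneg _) ((abs_nonneg _).trans (hSb N ω))
  have horth : ∀ N, ∫ ω, S N ω * D N ω ∂μ = 0 := fun N => by
    have := hz.integral_past_mul_increment hP N
      (fun b => ∑ t : Fin N, (h (b t.succ) - (P *ᵥ h) (b t.castSucc))) h
    rw [← this]
    refine integral_congr_ae (ae_of_all _ fun ω => ?_)
    simp only [S, D, Finset.sum_range, Fin.val_succ, Fin.val_castSucc]
  have hmom : ∀ N, ∫ ω, S N ω ^ 2 ∂μ ≤ K ^ 2 * N := fun N => by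
    induction N with
    | zero => simp [S]
    | succ N ih =>
      have hexp : ∀ ω, S (N + 1) ω ^ 2 = S N ω ^ 2 + 2 * (S N ω * D N ω) + D N ω ^ 2 := fun ω => by
        simp only [S, Finset.sum_range_succ]; ring
      have hD2 : ∫ ω, D N ω ^ 2 ∂μ ≤ K ^ 2 := by
        have := integral_mono (hDDint N) (integrable_const (K ^ 2)) fun ω => by
          have := pow_le_pow_left₀ (abs_nonneg _) (hK N ω) 2
          rwa [sq_abs] at this
        simpa using this
      simp only [hexp]
      have hSSD : Integrable (fun ω => S N ω ^ 2 + 2 * (S N ω * D N ω)) μ :=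
        (hSSint N).add ((hSDint N).const_mul 2)
      rw [integral_add hSSD (hDDint N), integral_add (hSSint N) ((hSDint N).const_mul 2),
        integral_const_mul, horth]
      push_cast
      linarith
  have hsq : ∀ᵐ ω ∂μ, Tendsto (fun k : ℕ => (S ((k + 1) ^ 2) ω / ((k + 1 : ℕ) : ℝ) ^ 2) ^ 2)
      atTop (𝓝 0) := by
    refine ae_tendsto_zero_of_summable_integral (fun k ω => sq_nonneg _)
      (fun k => ((hSm _).div_const _).pow_const 2)
      (fun k => by simpa only [div_pow] using (hSSint _).div_const _) ?_
    have hsum : Summable fun k : ℕ => K ^ 2 * (1 / ((k + 1 : ℕ) : ℝ) ^ 2) :=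
      ((summable_nat_add_iff 1).2 (Real.summable_one_div_nat_pow.2 one_lt_two)).mul_left _
    refine Summable.of_nonneg_of_le (fun k => integral_nonneg fun ω => sq_nonneg _)
      (fun k => ?_) hsum
    simp only [div_pow]
    rw [integral_div, div_le_iff₀ (by positivity)]
    refine (hmom _).trans (le_of_eq ?_)
    push_cast
    field_simp
  filter_upwards [hsq] with ω hω
  refine tendsto_div_of_tendsto_div_sq (S := fun N => S N ω) (K := K) (fun N => ?_) ?_
  · simpa [S, Finset.sum_range_succ] using hK N ω
  · have := hω.sqrt
    simp only [Real.sqrt_sq_eq_abs, Real.sqrt_zero] at this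
    exact (tendsto_zero_iff_abs_tendsto_zero _).2 this

/-- Ergodic theorem: by the Poisson equation, the centred partial sums of an observable are a
martingale up to a bounded error. -/
theorem ae_tendsto_average [DecidableEq Z] [IsProbabilityMeasure μ]
    (hP : P ∈ rowStochastic ℝ Z) (hz : IsMarkovChain P μ z) {π : Z → ℝ} (hπ1 : ∑ z, π z = 1)
    (hπP : π ᵥ* P = π) {z₀ : Z}
    (hreach : ∀ z, Relation.ReflTransGen (fun a b => 0 < P a b) z z₀) (f : Z → ℝ) :
    ∀ᵐ ω ∂μ, Tendsto (fun N : ℕ => (1 / ((N : ℝ) + 1)) * ∑ t ∈ Finset.range (N + 1), f (z t ω))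
      atTop (𝓝 (π ⬝ᵥ f)) := by
  obtain ⟨h, hh⟩ := exists_poisson_solution hP hπ1 hπP hreach f
  obtain ⟨C, hC⟩ : ∃ C : ℝ, ∀ a b, |h a - h b| ≤ C := by
    refine ⟨∑ a, ∑ b, |h a - h b|, fun a b => ?_⟩
    refine le_trans ?_ (Finset.single_le_sum (f := fun a => ∑ b, |h a - h b|)
      (fun a _ => Finset.sum_nonneg fun b _ => abs_nonneg _) (Finset.mem_univ a))
    exact Finset.single_le_sum (f := fun b => |h a - h b|)
      (fun b _ => abs_nonneg _) (Finset.mem_univ b)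
  filter_upwards [hz.ae_tendsto_martingale_div hP h] with ω hω
  have htel : ∀ N : ℕ, ∑ t ∈ Finset.range (N + 1), f (z t ω) =
      ((N : ℝ) + 1) * (π ⬝ᵥ f) + (h (z 0 ω) - h (z (N + 1) ω)) +
        ∑ t ∈ Finset.range (N + 1), (h (z (t + 1) ω) - (P *ᵥ h) (z t ω)) := fun N => by
    rw [← Finset.sum_range_sub' (fun t => h (z t ω)), add_assoc, ← Finset.sum_add_distrib]
    have hc : ((N : ℝ) + 1) * (π ⬝ᵥ f) = ∑ _t ∈ Finset.range (N + 1), π ⬝ᵥ f := by simp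
    rw [hc, ← Finset.sum_add_distrib]
    refine Finset.sum_congr rfl fun t _ => ?_
    have := hh (z t ω)
    linarith
  have hbd : Tendsto (fun N : ℕ => (h (z 0 ω) - h (z (N + 1) ω)) / ((N : ℝ) + 1)) atTop (𝓝 0) := by
    refine squeeze_zero_norm (a := fun N : ℕ => C * (1 / ((N : ℝ) + 1))) (fun N => ?_) ?_
    · rw [Real.norm_eq_abs, abs_div, abs_of_pos (by positivity : (0 : ℝ) < (N : ℝ) + 1),
        mul_one_div]
      gcongr
      exact hC _ _
    · simpa using (tendsto_one_div_add_atTop_nhds_zero_nat (𝕜 := ℝ)).const_mul C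
  have hlim := (hbd.add hω).const_add (π ⬝ᵥ f)
  rw [add_zero, add_zero] at hlim
  refine hlim.congr fun N => ?_
  rw [htel]
  have : (N : ℝ) + 1 ≠ 0 := by positivity
  field_simp
  ring

end IsMarkovChain

end ErgodicTheorem

/-! ### Payoff-based log-linear learning as a Markov chain -/

section LearningChain

open Matrix

variable {I : Type*} {Act : I → Type*}

/-- A state of the learning process: the previous profile, the current profile and the
experimentation flags. -/
abbrev LearningState (I : Type*) (Act : I → Type*) : Type _ :=
  ((i : I) → Act i) × ((i : I) → Act i) × (I → Bool)

/-- The probability that the experimentation flag of a player changes from the first to the second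
value, when a player that is not experimenting starts to do so with probability `δ`. -/
def flagProb (δ : ℝ) : Bool → Bool → ℝ
  | false, true => δ
  | false, false => 1 - δ
  | true, true => 0
  | true, false => 1

theorem flagProb_nonneg {δ : ℝ} (h0 : 0 ≤ δ) (h1 : δ ≤ 1) (b c : Bool) : 0 ≤ flagProb δ b c := by
  cases b <;> cases c <;> simp [flagProb, h0, h1]

theorem flagProb_le_one {δ : ℝ} (h0 : 0 ≤ δ) (h1 : δ ≤ 1) (b c : Bool) : flagProb δ b c ≤ 1 := by
  cases b <;> cases c <;> simp [flagProb, h0, h1]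

theorem sum_flagProb (δ : ℝ) (b : Bool) : ∑ c, flagProb δ b c = 1 := by
  cases b <;> simp [flagProb]

section RevertProb

variable (U : I → ((i : I) → Act i) → ℝ) {ε : ℝ}

theorem revertProb_nonneg (hε : 0 < ε) (p a : (i : I) → Act i) (i : I) :
    0 ≤ revertProb U ε p a i :=
  div_nonneg (Real.rpow_nonneg hε.le _)
    (add_nonneg (Real.rpow_nonneg hε.le _) (Real.rpow_nonneg hε.le _))

theorem one_sub_revertProb (hε : 0 < ε) (p a : (i : I) → Act i) (i : I) :
    1 - revertProb U ε p a i = ε ^ (-U i a) / (ε ^ (-U i p) + ε ^ (-U i a)) := by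
  have h1 := Real.rpow_pos_of_pos hε (-U i p)
  have h2 := Real.rpow_pos_of_pos hε (-U i a)
  rw [revertProb, eq_div_iff (by positivity)]
  field_simp
  ring

theorem one_sub_revertProb_pos (hε : 0 < ε) (p a : (i : I) → Act i) (i : I) :
    0 < 1 - revertProb U ε p a i := by
  rw [one_sub_revertProb U hε]
  have h1 := Real.rpow_pos_of_pos hε (-U i p)
  have h2 := Real.rpow_pos_of_pos hε (-U i a)
  positivity

end RevertProb

variable [∀ i, DecidableEq (Act i)]

/-- The distribution of the next action of player `i` given that it does not start to experiment:
an experimenting player settles, and the other players repeat their actions. -/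
noncomputable def settleProb (U : I → ((i : I) → Act i) → ℝ) (ε : ℝ) (p a : (i : I) → Act i)
    (i : I) : Bool → Act i → ℝ
  | false, c => if c = a i then 1 else 0
  | true, c => revertProb U ε p a i * (if c = p i then 1 else 0) +
      (1 - revertProb U ε p a i) * (if c = a i then 1 else 0)

variable {U : I → ((i : I) → Act i) → ℝ} {ε m : ℝ}

theorem settleProb_nonneg (hε : 0 < ε) (p a : (i : I) → Act i) (i : I) (b : Bool) (c : Act i) :
    0 ≤ settleProb U ε p a i b c := by
  have h1 := revertProb_nonneg U hε p a i
  have h2 := (one_sub_revertProb_pos U hε p a i).le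
  cases b <;> simp only [settleProb]
  · split_ifs <;> norm_num
  · split_ifs <;> simp [h1, h2]

variable [∀ i, Fintype (Act i)]

theorem playerUpdate_nonneg (hε : 0 < ε) (hδ : ε ^ m ≤ 1) (p a : (i : I) → Act i) (i : I)
    (b : Bool) (c : Act i) (b' : Bool) : 0 ≤ playerUpdate U ε m p a i b c b' := by
  have h0 := Real.rpow_nonneg hε.le m
  have h1 := revertProb_nonneg U hε p a i
  have h2 := (one_sub_revertProb_pos U hε p a i).le
  have hi : ∀ q : Prop, ∀ _ : Decidable q, (0 : ℝ) ≤ if q then 1 else 0 := fun q _ => by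
    split_ifs <;> norm_num
  cases b <;> cases b' <;> simp only [playerUpdate]
  · exact mul_nonneg (sub_nonneg.2 hδ) (hi _ _)
  · positivity
  · exact add_nonneg (mul_nonneg h1 (hi _ _)) (mul_nonneg h2 (hi _ _))
  · exact le_rfl

theorem sum_playerUpdate [∀ i, Nonempty (Act i)] (p a : (i : I) → Act i) (i : I) (b b' : Bool) :
    ∑ c, playerUpdate U ε m p a i b c b' = flagProb (ε ^ m) b b' := by
  cases b <;> cases b' <;> simp only [playerUpdate, flagProb]
  · simp
  · have : (Fintype.card (Act i) : ℝ) ≠ 0 := by exact_mod_cast Fintype.card_ne_zero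
    rw [Finset.sum_const, Finset.card_univ, nsmul_eq_mul]
    field_simp
  · simp [Finset.sum_add_distrib]
  · simp

theorem playerUpdate_eq_mul_settleProb (p a : (i : I) → Act i) (i : I) (b : Bool) (c : Act i) :
    playerUpdate U ε m p a i b c false = flagProb (ε ^ m) b false * settleProb U ε p a i b c := by
  cases b <;> simp [playerUpdate, flagProb, settleProb]

theorem sum_settleProb (p a : (i : I) → Act i) (i : I) (b : Bool) :
    ∑ c, settleProb U ε p a i b c = 1 := by
  cases b <;> simp [settleProb, Finset.sum_add_distrib]

variable [Fintype I]

/-- The transition matrix of payoff-based log-linear learning. -/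
noncomputable def learningMatrix (U : I → ((i : I) → Act i) → ℝ) (ε m : ℝ) :
    Matrix (LearningState I Act) (LearningState I Act) ℝ :=
  fun z z' => if z'.1 = z.2.1 then
    ∏ i, playerUpdate U ε m z.1 z.2.1 i (z.2.2 i) (z'.2.1 i) (z'.2.2 i) else 0

/-- The players can stop experimenting, then all experiment with the action given by `a₀`, and then
all keep it. -/
theorem learningMatrix_reachable [∀ i, Nonempty (Act i)] (hε : 0 < ε) (hδ : ε ^ m < 1)
    (a₀ : (i : I) → Act i) (z : LearningState I Act) :
    Relation.ReflTransGen (fun y y' => 0 < learningMatrix U ε m y y') z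
      (a₀, a₀, fun _ => false) := by
  have h0 := Real.rpow_pos_of_pos hε m
  have hkeep : ∀ (p a : (i : I) → Act i) (i : I) (b : Bool),
      0 < playerUpdate U ε m p a i b (a i) false := by
    intro p a i b
    rw [playerUpdate_eq_mul_settleProb]
    have h1 := revertProb_nonneg U hε p a i
    have h2 := one_sub_revertProb_pos U hε p a i
    cases b
    · simp only [flagProb, settleProb, if_true, mul_one]
      linarith
    · simp only [flagProb, settleProb, if_true, mul_one, one_mul]
      split_ifs <;> linarith
  have hexp : ∀ (p a : (i : I) → Act i) (i : I) (c : Act i),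
      0 < playerUpdate U ε m p a i false c true := by
    intro p a i c
    have : (0 : ℝ) < Fintype.card (Act i) := by exact_mod_cast Fintype.card_pos
    simp only [playerUpdate]
    positivity
  have s1 : 0 < learningMatrix U ε m z (z.2.1, z.2.1, fun _ => false) := by
    rw [learningMatrix, if_pos rfl]
    exact Finset.prod_pos fun i _ => hkeep _ _ _ _
  have s2 : 0 < learningMatrix U ε m (z.2.1, z.2.1, fun _ => false) (z.2.1, a₀, fun _ => true) := by
    rw [learningMatrix, if_pos rfl]
    exact Finset.prod_pos fun i _ => hexp _ _ _ _
  have s3 : 0 < learningMatrix U ε m (z.2.1, a₀, fun _ => true) (a₀, a₀, fun _ => false) := by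
    rw [learningMatrix, if_pos rfl]
    exact Finset.prod_pos fun i _ => hkeep _ _ _ _
  exact .head s1 (.head s2 (.single s3))

/-- A learning process yields a Markov chain of learning states. At time `0` the previous profile
is taken to be the current one, in accordance with the truncated subtraction in `IsPBLLL`. -/
theorem IsPBLLL.isMarkovChain {Ω : Type*} [MeasurableSpace Ω] {μ : Measure Ω}
    {p : ℕ → Ω → (i : I) → Act i} {x : ℕ → Ω → I → Bool} (h : IsPBLLL U ε m μ p x) :
    IsMarkovChain (learningMatrix U ε m) μ fun t ω => (p (t - 1) ω, p t ω, x t ω) where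
  measurableSet_state t a := by
    have h1 : MeasurableSet {ω | p (t - 1) ω = a.1} := by
      have : {ω | p (t - 1) ω = a.1} = ⋃ b : I → Bool, {ω | p (t - 1) ω = a.1 ∧ x (t - 1) ω = b} := by
        ext ω; simp
      rw [this]
      exact MeasurableSet.iUnion fun b => h.measurableSet_state _ _ _
    have : {ω | (p (t - 1) ω, p t ω, x t ω) = a} =
        {ω | p (t - 1) ω = a.1} ∩ {ω | p t ω = a.2.1 ∧ x t ω = a.2.2} := by
      ext ω; simp [Prod.ext_iff]
    rw [this]
    exact h1.inter (h.measurableSet_state _ _ _)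
  transition t a := by
    by_cases hc : ∀ s ≤ t + 1, (a s).1 = (a (s - 1)).2.1
    · have hset : ∀ r ≤ t + 1, {ω | ∀ s ≤ r, (p (s - 1) ω, p s ω, x s ω) = a s} =
          {ω | ∀ s ≤ r, p s ω = (a s).2.1 ∧ x s ω = (a s).2.2} := by
        intro r hr
        ext ω
        simp only [Set.mem_ofPred_eq, Prod.ext_iff]
        refine ⟨fun H s hs => (H s hs).2, fun H s hs => ⟨?_, H s hs⟩⟩
        rw [hc s (hs.trans hr)]
        exact (H (s - 1) ((Nat.sub_le s 1).trans hs)).1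
      rw [hset _ le_rfl, hset t (Nat.le_succ t),
        h.transition t (fun s => (a s).2.1) (fun s => (a s).2.2), learningMatrix,
        if_pos (show (a (t + 1)).1 = (a t).2.1 from hc (t + 1) le_rfl), hc t (Nat.le_succ t)]
    · -- an inconsistent path has probability zero on both sides
      push Not at hc
      obtain ⟨s, hs, hne⟩ := hc
      have hempty : ∀ r, s ≤ r → {ω | ∀ s ≤ r, (p (s - 1) ω, p s ω, x s ω) = a s} = ∅ := by
        intro r hr
        ext ω
        simp only [Set.mem_ofPred_eq, Set.mem_empty_iff_false, iff_false]
        intro H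
        refine hne ?_
        rw [← H s hr, ← H (s - 1) ((Nat.sub_le s 1).trans hr)]
      rw [hempty (t + 1) hs]
      rcases Nat.lt_or_ge s (t + 1) with hlt | hge
      · rw [hempty t (Nat.lt_succ_iff.1 hlt)]
        simp
      · obtain rfl : s = t + 1 := le_antisymm hs hge
        rw [learningMatrix, if_neg (show ¬(a (t + 1)).1 = (a t).2.1 from hne)]
        simp

variable [DecidableEq I]

/-- The expectation of `G` after all current experiments are settled and no new ones are made. -/
noncomputable def settledMean (U : I → ((i : I) → Act i) → ℝ) (ε : ℝ) (G : ((i : I) → Act i) → ℝ)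
    (z : LearningState I Act) : ℝ :=
  ∑ b : (i : I) → Act i, (∏ i, settleProb U ε z.1 z.2.1 i (z.2.2 i) (b i)) * G b

theorem sum_prod_eq_prod_sum {κ : I → Type*} [∀ i, Fintype (κ i)] (q : (i : I) → κ i → ℝ) :
    ∑ b : (i : I) → κ i, ∏ i, q i (b i) = ∏ i, ∑ c, q i c := by
  rw [Finset.prod_univ_sum, Fintype.piFinset_univ]

/-- An average over profiles with product weights is bounded by the total weight times a bound of
the averaged function. -/
theorem abs_sum_prod_mul_le {κ : I → Type*} [∀ i, Fintype (κ i)] {q : (i : I) → κ i → ℝ}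
    (hq : ∀ i c, 0 ≤ q i c) {G : ((i : I) → κ i) → ℝ} {K : ℝ} (hG : ∀ b, |G b| ≤ K) :
    |∑ b : (i : I) → κ i, (∏ i, q i (b i)) * G b| ≤ (∏ i, ∑ c, q i c) * K := by
  rw [← sum_prod_eq_prod_sum, Finset.sum_mul]
  refine (Finset.abs_sum_le_sum_abs _ _).trans (Finset.sum_le_sum fun b _ => ?_)
  have h0 : 0 ≤ ∏ i, q i (b i) := Finset.prod_nonneg fun i _ => hq i _
  rw [abs_mul, abs_of_nonneg h0]
  exact mul_le_mul_of_nonneg_left (hG b) h0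

/-- If all factors of a product weight other than the `i`-th one are concentrated at `a`, the
weighted sum runs over the profiles that differ from `a` at most in the action of player `i`. -/
theorem sum_prod_mul_eq_sum_update {q : (i : I) → Act i → ℝ} {w : I → ℝ} {a : (i : I) → Act i}
    {i : I} (hq : ∀ j ≠ i, ∀ c, q j c = w j * if c = a j then 1 else 0)
    (G : ((i : I) → Act i) → ℝ) :
    ∑ b : (i : I) → Act i, (∏ j, q j (b j)) * G b =
      ∑ c, q i c * (∏ j ∈ Finset.univ.erase i, w j) * G (Function.update a i c) := by
  symm
  refine Fintype.sum_of_injective (fun c => Function.update a i c)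
    (Function.update_injective a i) _ _ ?_ ?_
  · intro b hb
    have hne : ∃ j, j ≠ i ∧ b j ≠ a j := by
      by_contra! hcon
      refine hb ⟨b i, ?_⟩
      funext j
      by_cases hj : j = i
      · subst hj; simp
      · simp [Function.update_of_ne hj, hcon j hj]
    obtain ⟨j, hji, hbj⟩ := hne
    rw [Finset.prod_eq_zero (Finset.mem_univ j) (by rw [hq j hji]; simp [hbj]), zero_mul]
  · intro c
    rw [← Finset.mul_prod_erase Finset.univ _ (Finset.mem_univ i), Function.update_self]
    congr 2
    refine Finset.prod_congr rfl fun j hj => ?_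
    have hji := Finset.ne_of_mem_erase hj
    rw [hq j hji, Function.update_of_ne hji]
    simp

theorem learningMatrix_mulVec (g : LearningState I Act → ℝ) (z : LearningState I Act) :
    (learningMatrix U ε m *ᵥ g) z = ∑ x' : I → Bool, ∑ a' : (i : I) → Act i,
      (∏ i, playerUpdate U ε m z.1 z.2.1 i (z.2.2 i) (a' i) (x' i)) * g (z.2.1, a', x') := by
  rw [Finset.sum_comm]
  simp only [mulVec, dotProduct, Fintype.sum_prod_type, learningMatrix, ite_mul, zero_mul]
  rw [Finset.sum_eq_single z.2.1]
  · simp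
  · intro p _ hp
    simp [hp]
  · simp

theorem sum_prod_flagProb (δ : ℝ) (x : I → Bool) :
    ∑ x' : I → Bool, ∏ i, flagProb δ (x i) (x' i) = 1 := by
  rw [sum_prod_eq_prod_sum (fun i c => flagProb δ (x i) c)]
  simp only [sum_flagProb, Finset.prod_const_one]

theorem learningMatrix_mem_rowStochastic [∀ i, Nonempty (Act i)] (hε : 0 < ε) (hδ : ε ^ m ≤ 1) :
    learningMatrix U ε m ∈ rowStochastic ℝ (LearningState I Act) := by
  refine mem_rowStochastic.2 ⟨fun z z' => ?_, ?_⟩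
  · unfold learningMatrix
    split_ifs
    · exact Finset.prod_nonneg fun i _ => playerUpdate_nonneg hε hδ _ _ _ _ _ _
    · exact le_rfl
  · funext z
    rw [learningMatrix_mulVec]
    simp only [Pi.one_apply, mul_one]
    rw [← sum_prod_flagProb (ε ^ m) z.2.2]
    refine Finset.sum_congr rfl fun x' _ => ?_
    rw [sum_prod_eq_prod_sum (fun i c => playerUpdate U ε m z.1 z.2.1 i (z.2.2 i) c (x' i))]
    simp only [sum_playerUpdate]

end LearningChain

/-! ### The generator of the learning chain to first order in the experimentation rate -/

section FirstOrder

open Matrix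

variable {I : Type*} {Act : I → Type*} [∀ i, Fintype (Act i)] [Fintype I]

theorem one_sub_le_prod_flagProb_false {δ : ℝ} (h0 : 0 ≤ δ) (h1 : δ ≤ 1) (x : I → Bool) :
    1 - Fintype.card I * δ ≤ ∏ i, flagProb δ (x i) false := by
  calc 1 - Fintype.card I * δ ≤ (1 - δ) ^ Fintype.card I := by
        have := one_add_mul_le_pow (a := -δ) (by linarith) (Fintype.card I)
        rw [← sub_eq_add_neg] at this
        linarith
    _ = ∏ _i : I, (1 - δ) := by rw [Finset.prod_const, Finset.card_univ]
    _ ≤ ∏ i, flagProb δ (x i) false := Finset.prod_le_prod (fun i _ => sub_nonneg.2 h1) fun i _ => by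
        cases x i <;> simp [flagProb, h0]

variable [DecidableEq I]

/-- Under a stationary distribution `π`, the probability of being at the profile `a` without any
experiments. -/
noncomputable def settledMass (π : LearningState I Act → ℝ) (a : (i : I) → Act i) : ℝ :=
  ∑ p, π (p, a, fun _ => false)

theorem sum_no_flags_eq (π : LearningState I Act → ℝ) (G : ((i : I) → Act i) → ℝ) :
    ∑ z, π z * (if z.2.2 = (fun _ => false) then G z.2.1 else 0) = ∑ a, settledMass π a * G a := by
  simp only [Fintype.sum_prod_type, settledMass, Finset.sum_mul]
  rw [Finset.sum_comm]
  refine Finset.sum_congr rfl fun a _ => Finset.sum_congr rfl fun p _ => ?_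
  rw [Finset.sum_eq_single (fun _ => false)]
  · simp
  · intro x _ hx
    simp [hx]
  · simp

variable [∀ i, DecidableEq (Act i)] {U : I → ((i : I) → Act i) → ℝ} {ε m : ℝ}

/-- The generator of log-linear learning: each player proposes a uniformly drawn action at unit rate
and settles at it with the log-linear probability. -/
noncomputable def logLinearGenerator (U : I → ((i : I) → Act i) → ℝ) (ε : ℝ)
    (G : ((i : I) → Act i) → ℝ) (a : (i : I) → Act i) : ℝ :=
  ∑ i, ∑ c, 1 / (Fintype.card (Act i) : ℝ) *
    (1 - revertProb U ε a (Function.update a i c) i) * (G (Function.update a i c) - G a)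

/-- The part of the expectation of `g` at the next state that comes from the next flags `x'`. -/
noncomputable def flagPart (U : I → ((i : I) → Act i) → ℝ) (ε m : ℝ)
    (g : LearningState I Act → ℝ) (z : LearningState I Act) (x' : I → Bool) : ℝ :=
  ∑ a' : (i : I) → Act i,
    (∏ i, playerUpdate U ε m z.1 z.2.1 i (z.2.2 i) (a' i) (x' i)) * g (z.2.1, a', x')

theorem abs_settledMean_le (hε : 0 < ε) {G : ((i : I) → Act i) → ℝ} {K : ℝ}
    (hG : ∀ b, |G b| ≤ K) (z : LearningState I Act) : |settledMean U ε G z| ≤ K := by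
  have := abs_sum_prod_mul_le (fun i c => settleProb_nonneg (U := U) hε z.1 z.2.1 i (z.2.2 i) c) hG
  simpa only [settledMean, sum_settleProb, Finset.prod_const_one, one_mul] using this

theorem settledMean_of_no_flags (G : ((i : I) → Act i) → ℝ) (p a : (i : I) → Act i) :
    settledMean U ε G (p, a, fun _ => false) = G a := by
  unfold settledMean
  rw [Finset.sum_eq_single a]
  · simp [settleProb]
  · intro b _ hb
    obtain ⟨i, hi⟩ := Function.ne_iff.1 hb
    rw [Finset.prod_eq_zero (Finset.mem_univ i) (by simp [settleProb, hi]), zero_mul]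
  · simp

/-- If exactly player `i` experiments, it either returns to its previous action or settles. -/
theorem settledMean_of_single_flag (G : ((i : I) → Act i) → ℝ) (a : (i : I) → Act i) (i : I)
    (c : Act i) :
    settledMean U ε G (a, Function.update a i c, Function.update (fun _ => false) i true) =
      revertProb U ε a (Function.update a i c) i * G a +
        (1 - revertProb U ε a (Function.update a i c) i) * G (Function.update a i c) := by
  unfold settledMean
  rw [sum_prod_mul_eq_sum_update (w := fun _ => 1) (a := a) (i := i)]
  · simp only [Function.update_self, settleProb, Finset.prod_const_one, mul_one, add_mul,
      Finset.sum_add_distrib, mul_assoc, ← Finset.mul_sum, ite_mul, one_mul, zero_mul,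
      Finset.sum_ite_eq', Finset.mem_univ, if_true, Function.update_eq_self]
  · intro j hj c'
    simp [Function.update_of_ne hj, settleProb]

/-- Without new experiments, the settled mean is preserved. -/
theorem flagPart_settledMean_of_no_flags (G : ((i : I) → Act i) → ℝ) (z : LearningState I Act) :
    flagPart U ε m (settledMean U ε G) z (fun _ => false) =
      (∏ i, flagProb (ε ^ m) (z.2.2 i) false) * settledMean U ε G z := by
  simp only [flagPart, settledMean_of_no_flags, playerUpdate_eq_mul_settleProb,
    Finset.prod_mul_distrib]
  simp only [settledMean, Finset.mul_sum, mul_assoc]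

theorem abs_flagPart_sub_le [∀ i, Nonempty (Act i)] (hε : 0 < ε) (hδ : ε ^ m ≤ 1)
    {g : LearningState I Act → ℝ} {K : ℝ} (hg : ∀ z, |g z| ≤ K) (z : LearningState I Act)
    (x' : I → Bool) :
    |flagPart U ε m g z x' - (∏ i, flagProb (ε ^ m) (z.2.2 i) (x' i)) * g z| ≤
      2 * K * ∏ i, flagProb (ε ^ m) (z.2.2 i) (x' i) := by
  have hW : 0 ≤ ∏ i, flagProb (ε ^ m) (z.2.2 i) (x' i) := Finset.prod_nonneg fun i _ =>
    flagProb_nonneg (Real.rpow_nonneg hε.le m) hδ _ _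
  have h1 := abs_sum_prod_mul_le (G := fun a' => g (z.2.1, a', x'))
    (fun i c => playerUpdate_nonneg (U := U) hε hδ z.1 z.2.1 i (z.2.2 i) c (x' i))
    (fun a' => hg (z.2.1, a', x'))
  simp only [sum_playerUpdate] at h1
  have h2 : |(∏ i, flagProb (ε ^ m) (z.2.2 i) (x' i)) * g z| ≤
      (∏ i, flagProb (ε ^ m) (z.2.2 i) (x' i)) * K := by
    rw [abs_mul, abs_of_nonneg hW]
    exact mul_le_mul_of_nonneg_left (hg z) hW
  refine (abs_sub _ _).trans ((add_le_add h1 h2).trans (le_of_eq ?_))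
  ring

theorem prod_flagProb_single (δ : ℝ) (i : I) :
    ∏ j, flagProb δ false (Function.update (fun _ => false) i true j : Bool) =
      δ * (1 - δ) ^ (Fintype.card I - 1) := by
  rw [← Finset.mul_prod_erase Finset.univ _ (Finset.mem_univ i), Function.update_self]
  have : ∀ j ∈ Finset.univ.erase i,
      flagProb δ false (Function.update (fun _ => false) i true j : Bool) = 1 - δ := fun j hj => by
    rw [Function.update_of_ne (Finset.ne_of_mem_erase hj), flagProb]
  rw [Finset.prod_congr rfl this, Finset.prod_const, Finset.card_erase_of_mem (Finset.mem_univ i),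
    Finset.card_univ, flagProb]

/-- A single new experiment contributes one move of log-linear learning. -/
theorem flagPart_sub_of_single_flag [∀ i, Nonempty (Act i)] (G : ((i : I) → Act i) → ℝ)
    (p a : (i : I) → Act i) (i : I) :
    flagPart U ε m (settledMean U ε G) (p, a, fun _ => false)
        (Function.update (fun _ => false) i true) -
      (∏ j, flagProb (ε ^ m) false (Function.update (fun _ => false) i true j : Bool)) *
        settledMean U ε G (p, a, fun _ => false) =
      ε ^ m * (1 - ε ^ m) ^ (Fintype.card I - 1) * ∑ c, 1 / (Fintype.card (Act i) : ℝ) *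
        (1 - revertProb U ε a (Function.update a i c) i) * (G (Function.update a i c) - G a) := by
  have hcard : (Fintype.card (Act i) : ℝ) ≠ 0 := by exact_mod_cast Fintype.card_ne_zero
  set e : I → Bool := Function.update (fun _ => false) i true with he
  have hpart : flagPart U ε m (settledMean U ε G) (p, a, fun _ => false) e = _ :=
    sum_prod_mul_eq_sum_update (q := fun j c => playerUpdate U ε m p a j false c (e j))
      (w := fun _ => 1 - ε ^ m) (a := a) (i := i) (fun j hj c => by
        simp [he, Function.update_of_ne hj, playerUpdate])
      fun b => settledMean U ε G (a, b, e)
  rw [hpart]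
  simp only [settledMean_of_single_flag, settledMean_of_no_flags, prod_flagProb_single, he,
    Function.update_self, playerUpdate, Finset.prod_const,
    Finset.card_erase_of_mem (Finset.mem_univ i), Finset.card_univ]
  have hone : G a = ∑ _c : Act i, 1 / (Fintype.card (Act i) : ℝ) * G a := by
    rw [Finset.sum_const, Finset.card_univ, nsmul_eq_mul]
    field_simp
  conv_lhs => rw [hone]
  rw [Finset.mul_sum, Finset.mul_sum, ← Finset.sum_sub_distrib]
  refine Finset.sum_congr rfl fun c _ => ?_
  rw [← hone]
  ring

/-- Two or more simultaneous experiments have a probability of second order. -/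
theorem prod_flagProb_le_sq {δ : ℝ} (h0 : 0 ≤ δ) (h1 : δ ≤ 1) {x' : I → Bool}
    (hx : x' ≠ fun _ => false) (hx1 : ∀ i, x' ≠ Function.update (fun _ => false) i true) :
    ∏ j, flagProb δ false (x' j) ≤ δ ^ 2 := by
  obtain ⟨i, hi⟩ := Function.ne_iff.1 hx
  obtain ⟨j, hj⟩ := Function.ne_iff.1 (hx1 i)
  have hji : j ≠ i := by
    rintro rfl
    simp only [Function.update_self] at hj
    simp_all
  rw [Function.update_of_ne hji] at hj
  have hi' : x' i = true := by simpa using hi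
  have hj' : x' j = true := by simpa using hj
  have hle : ∀ s : Finset I, ∏ k ∈ s, flagProb δ false (x' k) ≤ 1 := fun s =>
    Finset.prod_le_one (fun k _ => flagProb_nonneg h0 h1 _ _) fun k _ => flagProb_le_one h0 h1 _ _
  rw [← Finset.mul_prod_erase Finset.univ _ (Finset.mem_univ i),
    ← Finset.mul_prod_erase (Finset.univ.erase i) _
      (Finset.mem_erase.2 ⟨hji, Finset.mem_univ j⟩), hi', hj',
    show flagProb δ false true = δ from rfl]
  have := mul_le_mul_of_nonneg_left (hle ((Finset.univ.erase i).erase j)) (mul_nonneg h0 h0)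
  nlinarith

/-- The drift of the settled mean, decomposed according to the new experiments. -/
theorem learningMatrix_mulVec_sub (g : LearningState I Act → ℝ) (z : LearningState I Act) :
    (learningMatrix U ε m *ᵥ g) z - g z = ∑ x' : I → Bool,
      (flagPart U ε m g z x' - (∏ i, flagProb (ε ^ m) (z.2.2 i) (x' i)) * g z) := by
  rw [learningMatrix_mulVec, Finset.sum_sub_distrib, ← Finset.sum_mul, sum_prod_flagProb, one_mul]
  rfl

/-- From every state, the drift of a settled mean is of first order. -/
theorem abs_drift_le [∀ i, Nonempty (Act i)] (hε : 0 < ε) (hδ : ε ^ m ≤ 1)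
    {G : ((i : I) → Act i) → ℝ} {K : ℝ} (hK : 0 ≤ K) (hG : ∀ b, |G b| ≤ K)
    (z : LearningState I Act) :
    |(learningMatrix U ε m *ᵥ settledMean U ε G) z - settledMean U ε G z| ≤
      2 * K * (Fintype.card I * ε ^ m) := by
  have h0 := Real.rpow_nonneg hε.le m
  have hg := abs_settledMean_le (U := U) hε hG
  rw [learningMatrix_mulVec_sub, ← Finset.add_sum_erase _ _ (Finset.mem_univ (fun _ => false)),
    flagPart_settledMean_of_no_flags, sub_self, zero_add]
  refine (Finset.abs_sum_le_sum_abs _ _).trans ?_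
  refine (Finset.sum_le_sum fun x' _ => abs_flagPart_sub_le hε hδ hg z x').trans ?_
  rw [← Finset.mul_sum]
  refine mul_le_mul_of_nonneg_left ?_ (by positivity)
  have h1 := sum_prod_flagProb (ε ^ m) z.2.2
  rw [← Finset.add_sum_erase _ _ (Finset.mem_univ (fun _ => false))] at h1
  have h2 := one_sub_le_prod_flagProb_false h0 hδ z.2.2
  linarith

/-- From a state without experiments, the drift of a settled mean is given by the generator of
log-linear learning, up to an error of second order. -/
theorem abs_drift_sub_generator_le [∀ i, Nonempty (Act i)] (hε : 0 < ε) (hδ : ε ^ m ≤ 1)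
    {G : ((i : I) → Act i) → ℝ} {K : ℝ} (hK : 0 ≤ K) (hG : ∀ b, |G b| ≤ K)
    (p a : (i : I) → Act i) :
    |(learningMatrix U ε m *ᵥ settledMean U ε G) (p, a, fun _ => false) -
        settledMean U ε G (p, a, fun _ => false) -
        ε ^ m * (1 - ε ^ m) ^ (Fintype.card I - 1) * logLinearGenerator U ε G a| ≤
      2 ^ Fintype.card I * (2 * K * (ε ^ m) ^ 2) := by
  have h0 := Real.rpow_nonneg hε.le m
  have hg := abs_settledMean_le (U := U) hε hG
  set z : LearningState I Act := (p, a, fun _ => false) with hz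
  set τ : (I → Bool) → ℝ := fun x' => flagPart U ε m (settledMean U ε G) z x' -
    (∏ i, flagProb (ε ^ m) (z.2.2 i) (x' i)) * settledMean U ε G z with hτ
  set e : I → I → Bool := fun i => Function.update (fun _ => false) i true with he
  have hinj : Function.Injective e := fun i j hij => by
    by_contra hne
    have := congrFun hij i
    simp [e, Function.update_of_ne hne] at this
  have hτe : ∑ i, τ (e i) =
      ε ^ m * (1 - ε ^ m) ^ (Fintype.card I - 1) * logLinearGenerator U ε G a := by
    rw [logLinearGenerator, Finset.mul_sum]
    exact Finset.sum_congr rfl fun i _ => flagPart_sub_of_single_flag G p a i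
  have hτ0 : τ (fun _ => false) = 0 := by
    simp only [hτ, flagPart_settledMean_of_no_flags, sub_self]
  rw [learningMatrix_mulVec_sub, ← hτe, ← Finset.sum_image (f := τ) (s := Finset.univ) (g := e)
    (fun i _ j _ h => hinj h), ← Finset.sum_sdiff (Finset.subset_univ (Finset.univ.image e)),
    add_sub_cancel_right]
  refine (Finset.abs_sum_le_sum_abs _ _).trans ?_
  have hterm : ∀ x' ∈ Finset.univ \ Finset.univ.image e, |τ x'| ≤ 2 * K * (ε ^ m) ^ 2 := by
    intro x' hx'
    have hx1 : ∀ i, x' ≠ e i := fun i hi => by simp [hi] at hx'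
    by_cases hx0 : x' = fun _ => false
    · rw [hx0, hτ0, abs_zero]
      positivity
    · exact (abs_flagPart_sub_le hε hδ hg z x').trans
        (mul_le_mul_of_nonneg_left (prod_flagProb_le_sq h0 hδ hx0 hx1) (by positivity))
  refine (Finset.sum_le_card_nsmul _ _ _ hterm).trans ?_
  rw [nsmul_eq_mul]
  refine mul_le_mul_of_nonneg_right ?_ (by positivity)
  have : (Finset.univ \ Finset.univ.image e).card ≤ 2 ^ Fintype.card I := by
    refine (Finset.card_le_univ _).trans (le_of_eq ?_)
    simp
  exact_mod_cast this

section Stationary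

variable {π : LearningState I Act → ℝ}

/-- Under a stationary distribution, experiments have a probability of first order. -/
theorem stationary_mass_no_flags_ge [∀ i, Nonempty (Act i)] (hε : 0 < ε) (hδ : ε ^ m ≤ 1)
    (h0 : ∀ z, 0 ≤ π z) (h1 : ∑ z, π z = 1) (hπ : π ᵥ* learningMatrix U ε m = π) :
    1 - Fintype.card I * ε ^ m ≤ ∑ z, π z * if z.2.2 = (fun _ => false) then 1 else 0 := by
  let g : LearningState I Act → ℝ := fun z => if z.2.2 = (fun _ => false) then 1 else 0
  have hstat : π ⬝ᵥ (learningMatrix U ε m *ᵥ g) = π ⬝ᵥ g := by rw [dotProduct_mulVec, hπ]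
  have hPg : ∀ z, (learningMatrix U ε m *ᵥ g) z = ∏ i, flagProb (ε ^ m) (z.2.2 i) false := by
    intro z
    rw [learningMatrix_mulVec, Finset.sum_eq_single (fun _ => false)]
    · simp only [g, if_true, mul_one]
      rw [sum_prod_eq_prod_sum fun i c => playerUpdate U ε m z.1 z.2.1 i (z.2.2 i) c false]
      simp only [sum_playerUpdate]
    · intro x' _ hx'
      simp [g, hx']
    · simp
  change _ ≤ π ⬝ᵥ g
  rw [← hstat]
  calc 1 - Fintype.card I * ε ^ m = ∑ z, π z * (1 - Fintype.card I * ε ^ m) := by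
        rw [← Finset.sum_mul, h1, one_mul]
    _ ≤ _ := Finset.sum_le_sum fun z _ => mul_le_mul_of_nonneg_left
        (by rw [hPg]; exact one_sub_le_prod_flagProb_false (Real.rpow_nonneg hε.le m) hδ _) (h0 z)

/-- The settled masses are almost invariant under log-linear learning. -/
theorem abs_sum_settledMass_mul_generator_le [∀ i, Nonempty (Act i)] (hε : 0 < ε)
    (hδ : Fintype.card I * ε ^ m ≤ 1 / 2) (hδ1 : ε ^ m ≤ 1)
    (h0 : ∀ z, 0 ≤ π z) (h1 : ∑ z, π z = 1) (hπ : π ᵥ* learningMatrix U ε m = π)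
    {G : ((i : I) → Act i) → ℝ} {K : ℝ} (hK : 0 ≤ K) (hG : ∀ b, |G b| ≤ K) :
    |∑ a, settledMass π a * logLinearGenerator U ε G a| ≤
      4 * (2 ^ Fintype.card I + (Fintype.card I : ℝ) ^ 2) * K * ε ^ m := by
  have hδ0 := Real.rpow_pos_of_pos hε m
  set δ := ε ^ m with hδdef
  set n : ℕ := Fintype.card I with hn
  set g := settledMean U ε G with hg
  set r := δ * (1 - δ) ^ (n - 1) with hr
  have hstat : ∑ z, π z * ((learningMatrix U ε m *ᵥ g) z - g z) = 0 := by
    have : π ⬝ᵥ (learningMatrix U ε m *ᵥ g) = π ⬝ᵥ g := by rw [dotProduct_mulVec, hπ]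
    simp only [mul_sub, Finset.sum_sub_distrib]
    exact sub_eq_zero.2 this
  let E : LearningState I Act → ℝ := fun z => (learningMatrix U ε m *ᵥ g) z - g z -
    if z.2.2 = (fun _ => false) then r * logLinearGenerator U ε G z.2.1 else 0
  have hE : ∀ z, |E z| ≤ 2 ^ n * (2 * K * δ ^ 2) +
      2 * K * (n * δ) * (1 - if z.2.2 = (fun _ => false) then 1 else 0) := by
    rintro ⟨p, a, x⟩
    by_cases hx : x = fun _ => false
    · subst hx
      simp only [E, if_true, sub_self, mul_zero, add_zero]
      exact abs_drift_sub_generator_le hε hδ1 hK hG p a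
    · simp only [E, hx, if_false, sub_zero, mul_one]
      have := abs_drift_le (U := U) (m := m) hε hδ1 hK hG (p, a, x)
      have h2 : 0 ≤ 2 ^ n * (2 * K * δ ^ 2) := by positivity
      linarith
  have hsum : r * ∑ a, settledMass π a * logLinearGenerator U ε G a = -∑ z, π z * E z := by
    rw [Finset.mul_sum]
    have := sum_no_flags_eq π fun a => r * logLinearGenerator U ε G a
    simp only [E, mul_sub, Finset.sum_sub_distrib] at hstat ⊢
    rw [hstat, this]
    simp only [zero_sub, neg_neg]
    exact Finset.sum_congr rfl fun a _ => by ring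
  have hEsum : |∑ z, π z * E z| ≤ 2 * (2 ^ n + (n : ℝ) ^ 2) * K * δ ^ 2 := by
    refine (Finset.abs_sum_le_sum_abs _ _).trans ?_
    have hmass := stationary_mass_no_flags_ge hε hδ1 h0 h1 hπ
    calc ∑ z, |π z * E z| ≤ ∑ z, (π z * (2 ^ n * (2 * K * δ ^ 2)) + 2 * K * (n * δ) *
          (π z - π z * if z.2.2 = (fun _ => false) then 1 else 0)) := by
          refine Finset.sum_le_sum fun z _ => ?_
          rw [abs_mul, abs_of_nonneg (h0 z)]
          refine (mul_le_mul_of_nonneg_left (hE z) (h0 z)).trans (le_of_eq ?_)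
          ring
      _ = 2 ^ n * (2 * K * δ ^ 2) + 2 * K * (n * δ) *
          (1 - ∑ z, π z * if z.2.2 = (fun _ => false) then 1 else 0) := by
          rw [Finset.sum_add_distrib, ← Finset.sum_mul, ← Finset.mul_sum, Finset.sum_sub_distrib,
            h1, one_mul]
      _ ≤ 2 ^ n * (2 * K * δ ^ 2) + 2 * K * (n * δ) * (n * δ) := by
          have : 0 ≤ 2 * K * (n * δ) := by positivity
          gcongr
          linarith
      _ = _ := by ring
  have hpow : (1 : ℝ) / 2 ≤ (1 - δ) ^ (n - 1) := by
    have h2 := one_add_mul_le_pow (a := -δ) (by linarith) n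
    rw [← sub_eq_add_neg] at h2
    have h3 : (1 - δ) ^ n ≤ (1 - δ) ^ (n - 1) :=
      pow_le_pow_of_le_one (by linarith) (by linarith) (Nat.sub_le n 1)
    linarith
  have hfin : δ / 2 * |∑ a, settledMass π a * logLinearGenerator U ε G a| ≤
      2 * (2 ^ n + (n : ℝ) ^ 2) * K * δ ^ 2 := by
    refine le_trans ?_ hEsum
    rw [← abs_neg (∑ z, π z * E z), ← hsum, abs_mul]
    refine mul_le_mul_of_nonneg_right ?_ (abs_nonneg _)
    refine le_trans ?_ (le_abs_self _)
    rw [hr]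
    nlinarith
  have : δ / 2 * |∑ a, settledMass π a * logLinearGenerator U ε G a| ≤
      δ / 2 * (4 * (2 ^ n + (n : ℝ) ^ 2) * K * δ) := hfin.trans (le_of_eq (by ring))
  exact le_of_mul_le_mul_left this (by positivity)

end Stationary

end FirstOrder

/-! ### Potential games: concentration on the maximizers of the potential -/

section PotentialGame

open Matrix

variable {I : Type*} {Act : I → Type*}

/-- `φ` is an exact potential of the game with utilities `U`. -/
def IsExactPotential [DecidableEq I] (U : I → ((i : I) → Act i) → ℝ) (φ : ((i : I) → Act i) → ℝ) :
    Prop :=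
  ∀ (a : (i : I) → Act i) (i : I) (c : Act i),
    U i (Function.update a i c) - U i a = φ (Function.update a i c) - φ a

/-- A function of profiles which varies by at most `η` under every change of a single action varies
by at most `η` times the number of players. -/
theorem abs_sub_le_card_mul_of_update [Fintype I] [DecidableEq I] {u : ((i : I) → Act i) → ℝ}
    {η : ℝ} (hu : ∀ a i c, |u (Function.update a i c) - u a| ≤ η) (a b : (i : I) → Act i) :
    |u b - u a| ≤ Fintype.card I * η := by
  have h : ∀ s : Finset I, |u (s.piecewise b a) - u a| ≤ s.card * η := by
    intro s
    induction s using Finset.induction_on with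
    | empty => simp
    | insert j s hj ih =>
      rw [Finset.piecewise_insert, Finset.card_insert_of_notMem hj]
      calc _ ≤ |u (Function.update (s.piecewise b a) j (b j)) - u (s.piecewise b a)| +
            |u (s.piecewise b a) - u a| := abs_sub_le _ _ _
        _ ≤ η + s.card * η := add_le_add (hu _ _ _) ih
        _ = _ := by push_cast; ring
  simpa using h Finset.univ

/-- The map that exchanges the action of player `i` in a profile with a separate action is an
involution, so the two end points of single-player moves may be exchanged under a sum. -/
theorem sum_sum_update_comm [Fintype I] [DecidableEq I] [∀ i, Fintype (Act i)] (i : I)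
    (F : ((i : I) → Act i) → ((i : I) → Act i) → ℝ) :
    ∑ a, ∑ c, F a (Function.update a i c) = ∑ a, ∑ c, F (Function.update a i c) a := by
  let e : ((i : I) → Act i) × Act i → ((i : I) → Act i) × Act i :=
    fun q => (Function.update q.1 i q.2, q.1 i)
  have he : Function.Involutive e := fun q => by simp [e]
  rw [← Fintype.sum_prod_type' fun a c => F a (Function.update a i c),
    ← Fintype.sum_prod_type' fun a c => F (Function.update a i c) a,
    ← Equiv.sum_comp he.toPerm]
  refine Finset.sum_congr rfl fun q _ => ?_
  simp [e]

variable [DecidableEq I] {U : I → ((i : I) → Act i) → ℝ} {φ : ((i : I) → Act i) → ℝ} {ε m : ℝ}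

theorem IsExactPotential.one_sub_revertProb (hφ : IsExactPotential U φ) (hε : 0 < ε)
    (a : (i : I) → Act i) (i : I) (c : Act i) :
    1 - revertProb U ε a (Function.update a i c) i =
      ε ^ (-φ (Function.update a i c)) / (ε ^ (-φ a) + ε ^ (-φ (Function.update a i c))) := by
  have hb : -U i (Function.update a i c) = -φ (Function.update a i c) + (φ a - U i a) := by
    have := hφ a i c
    linarith
  have ha : -U i a = -φ a + (φ a - U i a) := by ring
  rw [_root_.one_sub_revertProb U hε, hb, ha, Real.rpow_add hε, Real.rpow_add hε, ← add_mul]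
  exact mul_div_mul_right _ _ (Real.rpow_pos_of_pos hε _).ne'

variable [Fintype I] [∀ i, Fintype (Act i)]

/-- In a potential game, log-linear learning is reversible with respect to the weights
`ε ^ (-φ a)`, so its quadratic form is a sum of squares. -/
theorem IsExactPotential.sum_mul_generator (hφ : IsExactPotential U φ) (hε : 0 < ε)
    (u : ((i : I) → Act i) → ℝ) :
    ∑ a, ε ^ (-φ a) * u a * logLinearGenerator U ε u a =
      -(1 / 2) * ∑ i, 1 / (Fintype.card (Act i) : ℝ) * ∑ a, ∑ c,
        ε ^ (-φ a) * ε ^ (-φ (Function.update a i c)) /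
          (ε ^ (-φ a) + ε ^ (-φ (Function.update a i c))) *
            (u (Function.update a i c) - u a) ^ 2 := by
  set w : ((i : I) → Act i) → ℝ := fun a => ε ^ (-φ a) with hw
  let F : ((i : I) → Act i) → ((i : I) → Act i) → ℝ := fun a b =>
    w a * w b / (w a + w b) * (u a * (u b - u a))
  have hsym : ∀ i, ∑ a, ∑ c, F a (Function.update a i c) = -(1 / 2) * ∑ a, ∑ c : Act i,
      w a * w (Function.update a i c) / (w a + w (Function.update a i c)) *
        (u (Function.update a i c) - u a) ^ 2 := by
    intro i
    have h1 := sum_sum_update_comm i F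
    have h2 : ∑ a, ∑ c : Act i, F a (Function.update a i c) +
        ∑ a, ∑ c : Act i, F (Function.update a i c) a = -∑ a, ∑ c : Act i,
        w a * w (Function.update a i c) / (w a + w (Function.update a i c)) *
          (u (Function.update a i c) - u a) ^ 2 := by
      simp only [← Finset.sum_add_distrib, ← Finset.sum_neg_distrib]
      refine Finset.sum_congr rfl fun a _ => Finset.sum_congr rfl fun c _ => ?_
      simp only [F]
      rw [mul_comm (w (Function.update a i c)) (w a), add_comm (w (Function.update a i c)) (w a)]
      ring
    linarith
  calc ∑ a, w a * u a * logLinearGenerator U ε u a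
      = ∑ i, 1 / (Fintype.card (Act i) : ℝ) * ∑ a, ∑ c, F a (Function.update a i c) := by
        simp only [logLinearGenerator, Finset.mul_sum]
        rw [Finset.sum_comm]
        refine Finset.sum_congr rfl fun i _ => Finset.sum_congr rfl fun a _ =>
          Finset.sum_congr rfl fun c _ => ?_
        rw [hφ.one_sub_revertProb hε]
        simp only [F, hw]
        ring
    _ = _ := by
        simp only [hsym]
        rw [Finset.mul_sum]
        exact Finset.sum_congr rfl fun i _ => by ring

variable {π : LearningState I Act → ℝ}

theorem settledMass_nonneg (h0 : ∀ z, 0 ≤ π z) (a : (i : I) → Act i) : 0 ≤ settledMass π a :=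
  Finset.sum_nonneg fun _ _ => h0 _

theorem sum_settledMass (π : LearningState I Act → ℝ) :
    ∑ a, settledMass π a = ∑ z, π z * if z.2.2 = (fun _ => false) then 1 else 0 := by
  have := sum_no_flags_eq π fun _ : (i : I) → Act i => 1
  simpa using this.symm

theorem settledMass_le_one (h0 : ∀ z, 0 ≤ π z) (h1 : ∑ z, π z = 1) (a : (i : I) → Act i) :
    settledMass π a ≤ 1 := by
  refine (Finset.single_le_sum (fun b _ => settledMass_nonneg h0 b) (Finset.mem_univ a)).trans ?_
  rw [sum_settledMass]
  refine (Finset.sum_le_sum (g := π) fun z _ => ?_).trans h1.le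
  split_ifs <;> simp [h0 z]

variable [∀ i, DecidableEq (Act i)] [∀ i, Nonempty (Act i)]

/-- The density of the settled masses with respect to the Gibbs weights is almost constant: its
Dirichlet form is small, because the settled masses are almost invariant. -/
theorem IsExactPotential.exists_density_bound (hφ : IsExactPotential U φ)
    (hφ0 : ∀ a, 0 ≤ φ a) :
    ∃ C : ℝ, 0 ≤ C ∧ ∀ (ε m : ℝ), 0 < ε → ε < 1 → Fintype.card I * ε ^ m ≤ 1 / 2 → ε ^ m ≤ 1 →
      ∀ π : LearningState I Act → ℝ, (∀ z, 0 ≤ π z) → ∑ z, π z = 1 →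
        π ᵥ* learningMatrix U ε m = π → ∀ a b,
          |settledMass π b / ε ^ (-φ b) - settledMass π a / ε ^ (-φ a)| ≤ C * √(ε ^ m) := by
  set B : ℝ := 4 * (2 ^ Fintype.card I + (Fintype.card I : ℝ) ^ 2) with hB
  set R : ℝ := ∑ i, (Fintype.card (Act i) : ℝ) with hR
  have hB0 : 0 ≤ B := by positivity
  have hR0 : 0 ≤ R := Finset.sum_nonneg fun i _ => Nat.cast_nonneg _
  refine ⟨Fintype.card I * √(4 * B * R), by positivity, ?_⟩
  intro ε m hε hε1 hδ hδ1 π h0 h1 hπ a b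
  set w : ((i : I) → Act i) → ℝ := fun a => ε ^ (-φ a) with hw
  have hw1 : ∀ a, 1 ≤ w a := fun a =>
    Real.one_le_rpow_of_pos_of_le_one_of_nonpos hε hε1.le (neg_nonpos.2 (hφ0 a))
  have hwpos : ∀ a, 0 < w a := fun a => one_pos.trans_le (hw1 a)
  set u : ((i : I) → Act i) → ℝ := fun a => settledMass π a / w a with hu
  have hu1 : ∀ a, |u a| ≤ 1 := fun a => by
    rw [abs_of_nonneg (div_nonneg (settledMass_nonneg h0 a) (hwpos a).le), div_le_one (hwpos a)]
    exact (settledMass_le_one h0 h1 a).trans (hw1 a)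
  have hform := abs_sum_settledMass_mul_generator_le (U := U) hε hδ hδ1 h0 h1 hπ zero_le_one hu1
  have hwu : ∀ a, settledMass π a = w a * u a := fun a =>
    (mul_div_cancel₀ _ (hwpos a).ne').symm
  have hgen := hφ.sum_mul_generator hε u
  rw [Finset.sum_congr rfl fun a _ => congrArg (· * logLinearGenerator U ε u a) (hwu a), hgen,
    ← hB, mul_one] at hform
  have hstep : ∀ a i c, |u (Function.update a i c) - u a| ≤ √(4 * B * R) * √(ε ^ m) := by
    intro a i c
    have hterm0 : ∀ (a : (i : I) → Act i) (i : I) (c : Act i),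
        0 ≤ w a * w (Function.update a i c) / (w a + w (Function.update a i c)) *
          (u (Function.update a i c) - u a) ^ 2 := fun a i c => by
      have := hwpos a
      have := hwpos (Function.update a i c)
      positivity
    set k := w a * w (Function.update a i c) / (w a + w (Function.update a i c)) with hk
    have hk2 : 1 / 2 ≤ k := by
      have h1 := hw1 a
      have h2 := hw1 (Function.update a i c)
      rw [hk, div_le_div_iff₀ two_pos (by linarith)]
      nlinarith
    have hcard : (0 : ℝ) < Fintype.card (Act i) := by exact_mod_cast Fintype.card_pos
    have hcR : (Fintype.card (Act i) : ℝ) ≤ R :=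
      Finset.single_le_sum (f := fun i => (Fintype.card (Act i) : ℝ))
        (fun i _ => Nat.cast_nonneg _) (Finset.mem_univ i)
    have hle1 : k * (u (Function.update a i c) - u a) ^ 2 ≤ ∑ a, ∑ c : Act i,
        w a * w (Function.update a i c) / (w a + w (Function.update a i c)) *
          (u (Function.update a i c) - u a) ^ 2 := by
      refine le_trans ?_ (Finset.single_le_sum (f := fun a => ∑ c : Act i,
        w a * w (Function.update a i c) / (w a + w (Function.update a i c)) *
          (u (Function.update a i c) - u a) ^ 2)
        (fun a _ => Finset.sum_nonneg fun c _ => hterm0 a i c) (Finset.mem_univ a))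
      exact Finset.single_le_sum (f := fun c : Act i =>
        w a * w (Function.update a i c) / (w a + w (Function.update a i c)) *
          (u (Function.update a i c) - u a) ^ 2)
        (fun c _ => hterm0 a i c) (Finset.mem_univ c)
    have hle2 : 1 / (Fintype.card (Act i) : ℝ) * (k * (u (Function.update a i c) - u a) ^ 2) ≤
        2 * (B * ε ^ m) := by
      have h2 := Finset.single_le_sum (f := fun i => 1 / (Fintype.card (Act i) : ℝ) * ∑ a,
        ∑ c : Act i, w a * w (Function.update a i c) / (w a + w (Function.update a i c)) *
          (u (Function.update a i c) - u a) ^ 2)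
        (fun i _ => mul_nonneg (by positivity) (Finset.sum_nonneg fun a _ =>
          Finset.sum_nonneg fun c _ => hterm0 a i c)) (Finset.mem_univ i)
      have h3 := mul_le_mul_of_nonneg_left hle1 (by positivity : 0 ≤ 1 / (Fintype.card (Act i) : ℝ))
      have h4 : ∀ X Y : ℝ, -Y ≤ -(1 / 2) * X → X ≤ 2 * Y := fun X Y h => by linarith
      exact (h3.trans h2).trans (h4 _ _ (abs_le.1 hform).1)
    rw [← Real.sqrt_mul (mul_nonneg (mul_nonneg zero_le_four hB0) hR0)]
    refine Real.abs_le_sqrt ?_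
    rw [one_div, inv_mul_le_iff₀ hcard] at hle2
    have hδ0 := Real.rpow_nonneg hε.le m
    have h5 : 1 / 2 * (u (Function.update a i c) - u a) ^ 2 ≤
        k * (u (Function.update a i c) - u a) ^ 2 :=
      mul_le_mul_of_nonneg_right hk2 (sq_nonneg _)
    have h6 : Fintype.card (Act i) * (2 * (B * ε ^ m)) ≤ R * (2 * (B * ε ^ m)) :=
      mul_le_mul_of_nonneg_right hcR (by positivity)
    linarith
  rw [mul_assoc]
  exact abs_sub_le_card_mul_of_update hstep a b

/-- The stationary mean of the potential tends to its maximum, since a profile `a` has mass at most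
`ε ^ (M - φ a) + O(ε ^ (m / 2 - M))`. -/
theorem IsExactPotential.tendsto_stationary_mean (hφ : IsExactPotential U φ) (hφ0 : ∀ a, 0 ≤ φ a)
    (a₀ : (i : I) → Act i) (hmax : ∀ a, φ a ≤ φ a₀) (hm : 2 * φ a₀ + 1 ≤ m)
    {ρ : ℝ → LearningState I Act → ℝ}
    (hρ : ∀ ε, 0 < ε → ε < 1 → (∀ z, 0 ≤ ρ ε z) ∧ ∑ z, ρ ε z = 1 ∧
      ρ ε ᵥ* learningMatrix U ε m = ρ ε) :
    Tendsto (fun ε => ρ ε ⬝ᵥ fun z => φ z.2.1) (𝓝[>] 0) (𝓝 (φ a₀)) := by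
  obtain ⟨C, hC0, hC⟩ := hφ.exists_density_bound hφ0
  set M := φ a₀ with hM
  have hM0 : 0 ≤ M := hφ0 a₀
  have hm0 : 0 < m := by linarith
  have hpow : ∀ s : ℝ, 0 < s → Tendsto (fun ε : ℝ => ε ^ s) (𝓝[>] 0) (𝓝 0) := fun s hs => by
    have h := (Real.continuousAt_rpow_const 0 s (Or.inr hs.le)).tendsto
    rw [Real.zero_rpow hs.ne'] at h
    exact h.mono_left nhdsWithin_le_nhds
  let bound : ℝ → ℝ := fun ε => M * (Fintype.card I * ε ^ m) +
    ∑ a, ((M - φ a) * ε ^ (M - φ a) + (M - φ a) * (C * ε ^ (m / 2 - M)))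
  have hbound : Tendsto bound (𝓝[>] 0) (𝓝 0) := by
    have h1 : Tendsto (fun ε : ℝ => M * (Fintype.card I * ε ^ m)) (𝓝[>] 0) (𝓝 0) := by
      simpa using ((hpow m hm0).const_mul (Fintype.card I : ℝ)).const_mul M
    have h2 : ∀ a, Tendsto (fun ε : ℝ => (M - φ a) * ε ^ (M - φ a) +
        (M - φ a) * (C * ε ^ (m / 2 - M))) (𝓝[>] 0) (𝓝 0) := fun a => by
      have h3 : Tendsto (fun ε : ℝ => (M - φ a) * (C * ε ^ (m / 2 - M))) (𝓝[>] 0) (𝓝 0) := by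
        simpa using ((hpow (m / 2 - M) (by linarith)).const_mul C).const_mul (M - φ a)
      have h4 : Tendsto (fun ε : ℝ => (M - φ a) * ε ^ (M - φ a)) (𝓝[>] 0) (𝓝 0) := by
        rcases (sub_nonneg.2 (hmax a)).eq_or_lt with h | h
        · simp [← h]
        · simpa using (hpow _ h).const_mul (M - φ a)
      simpa using h4.add h3
    simpa using h1.add (tendsto_finsetSum Finset.univ fun a _ => h2 a)
  have hsmall : ∀ᶠ ε : ℝ in 𝓝[>] 0, Fintype.card I * ε ^ m ≤ 1 / 2 := by
    have h := (hpow m hm0).const_mul (Fintype.card I : ℝ)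
    rw [mul_zero] at h
    exact h.eventually (ge_mem_nhds (by norm_num))
  have hlt1 : ∀ᶠ ε : ℝ in 𝓝[>] 0, ε < 1 :=
    (eventually_lt_nhds one_pos).filter_mono nhdsWithin_le_nhds
  have hlow : ∀ᶠ ε : ℝ in 𝓝[>] 0, M - bound ε ≤ ρ ε ⬝ᵥ fun z => φ z.2.1 := by
    filter_upwards [hsmall, hlt1, self_mem_nhdsWithin] with ε hδ hε1 hε
    replace hε : 0 < ε := hε
    obtain ⟨h0, h1, hπ⟩ := hρ ε hε hε1
    have hδ1 : ε ^ m ≤ 1 := Real.rpow_le_one hε.le hε1.le hm0.le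
    have hmass := stationary_mass_no_flags_ge hε hδ1 h0 h1 hπ
    have hν : ∀ a, settledMass (ρ ε) a ≤ ε ^ (M - φ a) + C * ε ^ (m / 2 - M) := by
      intro a
      have hwa := Real.rpow_pos_of_pos hε (-φ a)
      have hw0 := Real.rpow_pos_of_pos hε (-M)
      have hd := (le_abs_self _).trans (hC ε m hε hε1 hδ hδ1 (ρ ε) h0 h1 hπ a₀ a)
      have h2 : settledMass (ρ ε) a₀ / ε ^ (-M) ≤ ε ^ M := by
        rw [Real.rpow_neg hε.le, div_inv_eq_mul]
        exact mul_le_of_le_one_left (Real.rpow_nonneg hε.le M) (settledMass_le_one h0 h1 a₀)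
      have h3 : settledMass (ρ ε) a / ε ^ (-φ a) ≤ ε ^ M + C * √(ε ^ m) := by linarith
      rw [div_le_iff₀ hwa] at h3
      have h4 : ε ^ M * ε ^ (-φ a) = ε ^ (M - φ a) := by
        rw [← Real.rpow_add hε, sub_eq_add_neg]
      have h5 : √(ε ^ m) * ε ^ (-M) = ε ^ (m / 2 - M) := by
        rw [Real.sqrt_eq_rpow, ← Real.rpow_mul hε.le, ← Real.rpow_add hε]
        congr 1
        ring
      have h6 : ε ^ (-φ a) ≤ ε ^ (-M) :=
        Real.rpow_le_rpow_of_exponent_ge hε hε1.le (neg_le_neg (hmax a))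
      calc settledMass (ρ ε) a ≤ (ε ^ M + C * √(ε ^ m)) * ε ^ (-φ a) := h3
        _ = ε ^ (M - φ a) + C * (√(ε ^ m) * ε ^ (-φ a)) := by rw [add_mul, h4, mul_assoc]
        _ ≤ ε ^ (M - φ a) + C * (√(ε ^ m) * ε ^ (-M)) := by gcongr
        _ = _ := by rw [h5]
    have hdef : M - ρ ε ⬝ᵥ (fun z => φ z.2.1) = ∑ z, ρ ε z * (M - φ z.2.1) := by
      simp only [dotProduct, mul_sub, Finset.sum_sub_distrib, ← Finset.sum_mul, h1, one_mul]
    have hsplit : ∑ z, ρ ε z * (M - φ z.2.1) ≤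
        M * (1 - ∑ z, ρ ε z * if z.2.2 = (fun _ => false) then 1 else 0) +
          ∑ a, settledMass (ρ ε) a * (M - φ a) := by
      have hM1 : M * (1 - ∑ z, ρ ε z * if z.2.2 = (fun _ => false) then 1 else 0) =
          ∑ z, ρ ε z * (M - M * if z.2.2 = (fun _ => false) then 1 else 0) := by
        simp only [mul_sub, Finset.sum_sub_distrib, ← Finset.sum_mul, h1, one_mul, mul_one,
          Finset.mul_sum, mul_left_comm]
      rw [← sum_no_flags_eq, hM1, ← Finset.sum_add_distrib]
      refine Finset.sum_le_sum fun z _ => ?_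
      have := mul_nonneg (h0 z) (hφ0 z.2.1)
      split_ifs <;> linarith
    have hsum : ∑ a, settledMass (ρ ε) a * (M - φ a) ≤
        ∑ a, ((M - φ a) * ε ^ (M - φ a) + (M - φ a) * (C * ε ^ (m / 2 - M))) :=
      Finset.sum_le_sum fun a _ => by
        have := mul_le_mul_of_nonneg_right (hν a) (sub_nonneg.2 (hmax a))
        linarith
    have hflag : M * (1 - ∑ z, ρ ε z * if z.2.2 = (fun _ => false) then 1 else 0) ≤
        M * (Fintype.card I * ε ^ m) := mul_le_mul_of_nonneg_left (by linarith) hM0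
    have : bound ε = M * (Fintype.card I * ε ^ m) +
      ∑ a, ((M - φ a) * ε ^ (M - φ a) + (M - φ a) * (C * ε ^ (m / 2 - M))) := rfl
    linarith
  have hupp : ∀ᶠ ε : ℝ in 𝓝[>] 0, ρ ε ⬝ᵥ (fun z => φ z.2.1) ≤ M := by
    filter_upwards [hlt1, self_mem_nhdsWithin] with ε hε1 hε
    obtain ⟨h0, h1, -⟩ := hρ ε hε hε1
    calc ρ ε ⬝ᵥ (fun z => φ z.2.1) ≤ ∑ z, ρ ε z * M :=
          Finset.sum_le_sum fun z _ => mul_le_mul_of_nonneg_left (hmax _) (h0 z)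
      _ = M := by rw [← Finset.sum_mul, h1, one_mul]
  refine tendsto_of_tendsto_of_tendsto_of_le_of_le' ?_ tendsto_const_nhds hlow hupp
  simpa using hbound.const_sub M

/-- Payoff-based log-linear learning in a potential game: for large `m`, the time averages of the
potential converge almost surely, and their limits tend to the maximal potential as `ε → 0`. -/
theorem IsExactPotential.exists_limit_of_averages (hφ : IsExactPotential U φ)
    (hφ0 : ∀ a, 0 ≤ φ a) (a₀ : (i : I) → Act i) (hmax : ∀ a, φ a ≤ φ a₀)
    (hm : 2 * φ a₀ + 1 ≤ m) :
    ∃ F : ℝ → ℝ,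
      (∀ ε : ℝ, 0 < ε → ε < 1 →
        ∀ (Ω : Type*) [MeasurableSpace Ω] (μ : Measure Ω) [IsProbabilityMeasure μ]
          (p : ℕ → Ω → (i : I) → Act i) (x : ℕ → Ω → I → Bool), IsPBLLL U ε m μ p x →
          ∀ᵐ ω ∂μ, Tendsto (fun N : ℕ => (1 / ((N : ℝ) + 1)) *
            ∑ t ∈ Finset.range (N + 1), φ (p t ω)) atTop (𝓝 (F ε))) ∧
      Tendsto F (𝓝[>] 0) (𝓝 (φ a₀)) := by
  have hm0 : 0 < m := by
    have := hφ0 a₀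
    linarith
  have hex : ∀ ε : ℝ, ∃ π : LearningState I Act → ℝ, 0 < ε → ε < 1 →
      (∀ z, 0 ≤ π z) ∧ ∑ z, π z = 1 ∧ π ᵥ* learningMatrix U ε m = π := by
    intro ε
    by_cases hε : 0 < ε ∧ ε < 1
    · obtain ⟨π, hπ⟩ := exists_stationary_distribution
        (learningMatrix_mem_rowStochastic (U := U) hε.1
          (Real.rpow_le_one hε.1.le hε.2.le hm0.le))
      exact ⟨π, fun _ _ => hπ⟩
    · exact ⟨0, fun h1 h2 => absurd ⟨h1, h2⟩ hε⟩
  choose ρ hρ using hex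
  refine ⟨fun ε => ρ ε ⬝ᵥ fun z => φ z.2.1, ?_,
    hφ.tendsto_stationary_mean hφ0 a₀ hmax hm hρ⟩
  intro ε hε hε1 Ω _ μ _ p x hpx
  obtain ⟨h0, h1, hπ⟩ := hρ ε hε hε1
  have hδ : ε ^ m < 1 := Real.rpow_lt_one hε.le hε1 hm0
  exact hpx.isMarkovChain.ae_tendsto_average (learningMatrix_mem_rowStochastic hε hδ.le) h1 hπ
    (learningMatrix_reachable hε hδ a₀) fun z => φ z.2.1

end PotentialGame

/-! ### The distributed task execution game -/

namespace DTEProblem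

variable {n k T : ℕ} (D : DTEProblem n k T)

theorem counter_mono {team team' : Finset (Fin n)} (h : team ⊆ team') (p : Fin n → Trajectory T)
    (j : Fin k) (t : Fin T) : D.counter team p j t ≤ D.counter team' p j t :=
  Finset.card_le_card (Finset.filter_subset_filter _ h)

theorem completed_mono {team team' : Finset (Fin n)} (h : team ⊆ team')
    (p : Fin n → Trajectory T) : D.completed team p ⊆ D.completed team' p := by
  intro j hj
  simp only [completed, Finset.mem_filter, Finset.mem_univ, true_and] at hj ⊢
  obtain ⟨t, h1, h2, h3⟩ := hj
  exact ⟨t, h1, h2, h3.trans (D.counter_mono h p j t)⟩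

/-- The tasks completed by a team depend only on the trajectories of its members. -/
theorem completed_congr {team : Finset (Fin n)} {p q : Fin n → Trajectory T}
    (h : ∀ i ∈ team, p i = q i) : D.completed team p = D.completed team q := by
  have hc : ∀ j t, D.counter team p j t = D.counter team q j t := fun j t => by
    unfold counter
    congr 1
    exact Finset.filter_congr fun i hi => by rw [h i hi]
  simp only [completed, hc]

theorem totalValue_nonneg (p : Fin n → Trajectory T) : 0 ≤ D.totalValue p :=
  Finset.sum_nonneg fun j _ => (D.task j).value_nonneg

/-- The wonderful-life utility is the marginal contribution of the robot to the total value. -/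
theorem wonderfulLife_eq_sub (i : Fin n) (p : Fin n → Trajectory T) :
    D.wonderfulLife i p =
      D.totalValue p - ∑ j ∈ D.completed (Finset.univ.erase i) p, (D.task j).value := by
  rw [wonderfulLife, totalValue,
    ← Finset.sum_sdiff (D.completed_mono (Finset.erase_subset i Finset.univ) p),
    add_sub_cancel_right]

theorem isExactPotential_totalValue (A : Fin n → Finset (Trajectory T)) :
    IsExactPotential (D.gameUtility A) fun a => D.totalValue fun i => (a i : Trajectory T) := by
  intro a i c
  have h : D.completed (Finset.univ.erase i)
        (fun j => ((Function.update a i c j : A j) : Trajectory T)) =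
      D.completed (Finset.univ.erase i) fun j => (a j : Trajectory T) :=
    D.completed_congr fun j hj => by rw [Function.update_of_ne (Finset.ne_of_mem_erase hj)]
  simp only [gameUtility, wonderfulLife_eq_sub, h]
  ring

/-- Enlarging the sets of stays can only complete more tasks. -/
theorem totalValue_le_of_stays {p q : Fin n → Trajectory T}
    (h : ∀ i (t : Fin T), q i t.castSucc = q i t.succ →
      p i t.castSucc = q i t.castSucc ∧ p i t.succ = q i t.castSucc) :
    D.totalValue q ≤ D.totalValue p := by
  refine Finset.sum_le_sum_of_subset_of_nonneg ?_ fun j _ _ => (D.task j).value_nonneg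
  intro j hj
  simp only [completed, Finset.mem_filter, Finset.mem_univ, true_and] at hj ⊢
  obtain ⟨t, h1, h2, h3⟩ := hj
  refine ⟨t, h1, h2, h3.trans (Finset.card_le_card ?_)⟩
  intro i hi
  simp only [Finset.mem_filter, Finset.mem_univ, true_and] at hi ⊢
  obtain ⟨hp1, hp2⟩ := h i t (hi.1.trans hi.2.symm)
  exact ⟨hp1.trans hi.1, hp2.trans hi.1⟩

theorem const_station_mem_feasible (i : Fin n) : (fun _ => D.station i) ∈ D.feasible i :=
  ⟨rfl, rfl, fun _ => ⟨D.stations_free (D.station_mem i), by simp, by simp⟩⟩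

variable {D}

/-- Every feasible trajectory is dominated by an action, as far as stays are concerned. -/
theorem IsAdmissibleActionSet.exists_stays {i : Fin n} {A : Finset (Trajectory T)}
    (hA : D.IsAdmissibleActionSet i A) {q : Trajectory T} (hq : q ∈ D.feasible i) :
    ∃ p ∈ A, ∀ t : Fin T, q t.castSucc = q t.succ →
      p t.castSucc = q t.castSucc ∧ p t.succ = q t.castSucc := by
  by_cases hqA : q ∈ A
  · exact ⟨q, hqA, fun t ht => ⟨rfl, ht.symm⟩⟩
  · exact hA.2.2 q hq hqA

end DTEProblem

theorem theorem1 {n k T : ℕ} (D : DTEProblem n k T)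
    (A : Fin n → Finset (Trajectory T)) (hA : ∀ i, D.IsActionSet i (A i)) :
    ∃ M : ℝ, IsGreatest (D.totalValue '' D.feasibleProfiles) M ∧
      ∃ m₀ : ℝ, 0 < m₀ ∧ ∀ m : ℝ, m₀ ≤ m →
        ∃ F : ℝ → ℝ,
          (∀ ε : ℝ, 0 < ε → ε < 1 →
            ∀ (Ω : Type*) [MeasurableSpace Ω] (μ : Measure Ω) [IsProbabilityMeasure μ]
              (p : ℕ → Ω → (i : Fin n) → A i) (x : ℕ → Ω → Fin n → Bool),
              IsPBLLL (D.gameUtility A) ε m μ p x →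
              ∀ᵐ ω ∂μ, Tendsto
                (fun N : ℕ => (1 / ((N : ℝ) + 1)) *
                  ∑ t ∈ Finset.range (N + 1),
                    D.totalValue (fun i => (p t ω i : Trajectory T)))
                atTop (𝓝 (F ε))) ∧
          Tendsto F (𝓝[>] 0) (𝓝 M) := by
  have hne : ∀ i, Nonempty (A i) := fun i =>
    let ⟨p, hp, _⟩ := (hA i).1.exists_stays (D.const_station_mem_feasible i)
    ⟨⟨p, hp⟩⟩
  let φ : ((i : Fin n) → A i) → ℝ := fun a => D.totalValue fun i => (a i : Trajectory T)
  obtain ⟨a₀, hmax⟩ := Finite.exists_max φ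
  have hφ0 : ∀ a, 0 ≤ φ a := fun a => D.totalValue_nonneg _
  refine ⟨φ a₀, ⟨⟨_, fun i => (hA i).1.1 _ (a₀ i).2, rfl⟩, ?_⟩, 2 * φ a₀ + 1, ?_, fun m hm => ?_⟩
  · rintro _ ⟨q, hq, rfl⟩
    choose p hpA hp using fun i => (hA i).1.exists_stays (hq i)
    exact (D.totalValue_le_of_stays hp).trans (hmax fun i => ⟨p i, hpA i⟩)
  · have := hφ0 a₀
    linarith
  · exact (D.isExactPotential_totalValue A).exists_limit_of_averages hφ0 a₀ hmax hm
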